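/- Conventions. Let $\mathbb K$ be $\mathbb R$ or $\mathbb C$. A Banach algebra dynamical system $(A,G,\alpha)$ consists of a (not necessarily unital) Banach algebra $A$ over $\mathbb K$, a locally compact Hausdorff group $G$ with left Haar measure $ds$ and modular function $\Delta$ (normalised by $\Delta(r)\int_G f(sr)\,ds=\int_G f(s)\,ds$ for $f\in C_c(G)$), and a strongly continuous action $\alpha$ of $G$ on $A$ by bounded algebra automorphisms. A continuous covariant representation $(\pi,U)$ on a Banach space $X$ consists of a bounded algebra homomorphism $\pi:A\to B(X)$ and a strongly continuous group homomorphism $U:G\to \mathrm{Inv}(X)$ into the invertible elements of $B(X)$ such that $\pi(\alpha_s(a))=U_s\pi(a)U_s^{-1}$; it is non-degenerate if the span of $\{\pi(a)x: a\in A,\,x\in X\}$ is dense in $X$. (Non-degeneracy of a representation of any other algebra is defined in the same way.) For $f\in C_c(G,A)$ put $\pi\rtimes U(f)x=\int_G\pi(f(s))U_sx\,ds$; this is multiplicative for the twisted convolution $[f*g](s)=\int_G f(r)\alpha_r(g(r^{-1}s))\,dr$. For a non-empty class $\mathcal R$ of continuous covariant representations on Banach spaces such that $\|\pi\|$, and $\|U_r\|$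 for $r$ in any given compact set, are bounded uniformly over $(\pi,U)\in\mathcal R$, let $\sigma^{\mathcal R}(f)=\sup_{(\pi,U)\in\mathcal R}\|\pi\rtimes U(f)\|$, and let $(A\rtimes_\alpha G)^{\mathcal R}$ be the Banach algebra obtained by completing $C_c(G,A)/\ker\sigma^{\mathcal R}$, with canonical map $q^{\mathcal R}:C_c(G,A)\to(A\rtimes_\alpha G)^{\mathcal R}$. For $(\pi,U)\in\mathcal R$, let $(\pi\rtimes U)^{\mathcal R}$ be the contractive representation of $(A\rtimes_\alpha G)^{\mathcal R}$ determined by $(\pi\rtimes U)^{\mathcal R}(q^{\mathcal R}(f))=\pi\rtimes U(f)$. The system is involutive if $\mathbb K=\mathbb C$, $A$ has a bounded involution and all $\alpha_s$ preserve it. A continuous covariant representation $(\pi,U)$ is involutive if its space is a Hilbert space, $\pi$ is a $*$-representation and $U$ is unitary; $\mathcal R$ is involutive if all its members are. If the system and $\mathcal R$ are involutive, the crossed product carries the involution with $q^{\mathcal R}(f)^*=q^{\mathcal R}(f^*)$, where $f^*(s)=\Delta(s^{-1})\alpha_s(f(s^{-1})^*)$. Theorem. Let $(A,G,\alpha)$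 be a Banach algebra dynamical system such that, for each $\varepsilon>0$, $A$ has a $(1+\varepsilon)$-bounded approximate left identity. Let $\mathcal Z$ be a neighbourhood basis of $e\in G$ all of whose elements are contained in a fixed compact set, and let $\nu:G\to[0,\infty)$ be bounded on compact sets with $\inf_{V\in\mathcal Z}\sup_{r\in V}\nu(r)=1$. Let $\mathcal R$ be a non-empty class of non-degenerate continuous covariant representations of $(A,G,\alpha)$ on Banach spaces such that, for all $(\pi,U)\in\mathcal R$, $\pi$ is contractive and $\|U_r\|\le\nu(r)$ for all $r\in G$. Let $\mathcal X$ be a class of Banach spaces, and suppose that $\mathcal R$ contains the class $\mathcal R'$ of all non-degenerate continuous covariant representations $(\pi,U)$ of $(A,G,\alpha)$ in spaces from $\mathcal X$ with $\pi$ contractive and $\|U_r\|\le\nu(r)$ for all $r\in G$. Suppose that $\mathcal R'$ is non-empty. Then: 1. The map $(\pi,U)\mapsto(\pi\rtimes U)^{\mathcal R}$, which preserves the representation space, is a bijection between $\mathcal R'$ and the non-degenerate contractive representations of $(A\rtimes_\alpha G)^{\mathcal R}$ in spaces from $\mathcal X$. 2. For $(\pi,U)\in\mathcal R'$, a closed subspace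 is invariant under both $\pi(A)$ and $U(G)$ if and only if it is invariant under $(\pi\rtimes U)^{\mathcal R}$. 3. For $(\pi,U),(\rho,V)\in\mathcal R'$ on spaces $X,Y$, a bounded operator $\Phi:X\to Y$ intertwines $\pi$ with $\rho$ and $U$ with $V$ if and only if it intertwines $(\pi\rtimes U)^{\mathcal R}$ and $(\rho\rtimes V)^{\mathcal R}$. 4. If $(A,G,\alpha)$ and $\mathcal R$ are involutive, then $(\pi,U)\in\mathcal R'$ is involutive if and only if $(\pi\rtimes U)^{\mathcal R}$ is an involutive representation of $(A\rtimes_\alpha G)^{\mathcal R}$. -/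

import Mathlib

open MeasureTheory Filter Topology Set
open scoped CompactlySupported NNReal

universe w

namespace BanachCP

noncomputable section

/-! ### Banach spaces, representations, bounded left approximate identities -/

/-- A Banach space over `𝕜`, bundled.  A class of Banach spaces is a `Set (BanachSp 𝕜)`. -/
structure BanachSp (𝕜 : Type*) [RCLike 𝕜] where
  /-- the underlying space -/
  carrier : Type w
  [normed : NormedAddCommGroup carrier]
  [space : NormedSpace 𝕜 carrier]
  [complete : CompleteSpace carrier]

instance (𝕜 : Type*) [RCLike 𝕜] : CoeSort (BanachSp.{w} 𝕜) (Type w) := ⟨BanachSp.carrier⟩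

attribute [instance] BanachSp.normed BanachSp.space BanachSp.complete

/-- `A` has an `M`-bounded left approximate identity (nets in `A` are encoded as filters). -/
def HasBddLeftApproxId (A : Type*) [NonUnitalNormedRing A] (M : ℝ) : Prop :=
  ∃ l : Filter A, l.NeBot ∧ (∀ᶠ u in l, ‖u‖ ≤ M) ∧ ∀ a : A, Tendsto (fun u => u * a) l (𝓝 a)

section Representations

variable {𝕜 : Type*} [RCLike 𝕜] {B : Type*} [NonUnitalNormedRing B] [NormedSpace 𝕜 B]
  {X : Type*} [NormedAddCommGroup X] [NormedSpace 𝕜 X]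
  {Y : Type*} [NormedAddCommGroup Y] [NormedSpace 𝕜 Y]

/-- The span of `{π(b)x}` is dense. -/
def RepNonDegenerate (π : B →ₙₐ[𝕜] (X →L[𝕜] X)) : Prop :=
  Dense (Submodule.span 𝕜 {y : X | ∃ (b : B) (x : X), y = π b x} : Set X)

/-- `‖π‖ ≤ 1`. -/
def RepContractive (π : B →ₙₐ[𝕜] (X →L[𝕜] X)) : Prop := ∀ b : B, ‖π b‖ ≤ ‖b‖

/-- The subspace `Z` is invariant under all `π(b)`. -/
def RepInvariant (π : B →ₙₐ[𝕜] (X →L[𝕜] X)) (Z : Submodule 𝕜 X) : Prop :=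
  ∀ b : B, ∀ x ∈ Z, π b x ∈ Z

/-- `Φ` intertwines `π` and `ρ`. -/
def RepIntertwines (π : B →ₙₐ[𝕜] (X →L[𝕜] X)) (ρ : B →ₙₐ[𝕜] (Y →L[𝕜] Y)) (Φ : X →L[𝕜] Y) : Prop :=
  ∀ b : B, ρ b ∘L Φ = Φ ∘L π b

/-- `π` is involutive with respect to the operation `st` on `B`: the norm of the representation
space `X` comes from an inner product for which `π(st b)` is the adjoint of `π(b)`. -/
def RepInvolutive (st : B → B) (π : B →ₙₐ[𝕜] (X →L[𝕜] X)) : Prop :=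
  ∃ H : InnerProductSpace 𝕜 X, H.toNormedSpace = ‹NormedSpace 𝕜 X› ∧
    ∀ (b : B) (x y : X), H.inner (π b x) y = H.inner x (π (st b) y)

end Representations

/-! ### The Bochner integral in a Banach space over `𝕜` -/

section Integral

variable (𝕜 : Type*) [RCLike 𝕜] {G : Type*} [MeasurableSpace G] (μ : Measure G)
  {X : Type*} [NormedAddCommGroup X] [NormedSpace 𝕜 X]

/-- The Bochner integral in a `𝕜`-normed space, seen as a real normed space. -/
def gint (f : G → X) : X :=
  letI : NormedSpace ℝ X := NormedSpace.restrictScalars ℝ 𝕜 X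
  ∫ s, f s ∂μ

variable {𝕜 μ}

theorem gint_add {f g : G → X} (hf : Integrable f μ) (hg : Integrable g μ) :
    gint 𝕜 μ (fun s => f s + g s) = gint 𝕜 μ f + gint 𝕜 μ g := by
  letI : NormedSpace ℝ X := NormedSpace.restrictScalars ℝ 𝕜 X
  exact integral_add hf hg

theorem gint_smul (c : 𝕜) (f : G → X) :
    gint 𝕜 μ (fun s => c • f s) = c • gint 𝕜 μ f := by
  letI : NormedSpace ℝ X := NormedSpace.restrictScalars ℝ 𝕜 X
  haveI : IsScalarTower ℝ 𝕜 X := RestrictScalars.isScalarTower ℝ 𝕜 X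
  haveI : SMulCommClass ℝ 𝕜 X := inferInstance
  exact integral_smul c f

theorem gint_comm {Y : Type*} [NormedAddCommGroup Y] [NormedSpace 𝕜 Y] [CompleteSpace X]
    [CompleteSpace Y] (L : X →L[𝕜] Y) {f : G → X} (hf : Integrable f μ) :
    gint 𝕜 μ (fun s => L (f s)) = L (gint 𝕜 μ f) := by
  letI : NormedSpace ℝ X := NormedSpace.restrictScalars ℝ 𝕜 X
  letI : NormedSpace ℝ Y := NormedSpace.restrictScalars ℝ 𝕜 Y
  exact L.integral_comp_comm hf

theorem norm_gint_le {f : G → X} : ‖gint 𝕜 μ f‖ ≤ ∫ s, ‖f s‖ ∂μ := by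
  letI : NormedSpace ℝ X := NormedSpace.restrictScalars ℝ 𝕜 X
  exact norm_integral_le_integral_norm f

theorem gint_eq_integral (f : G → 𝕜) : gint 𝕜 μ f = ∫ s, f s ∂μ := by
  have : NormedSpace.restrictScalars ℝ 𝕜 𝕜 = (inferInstance : NormedSpace ℝ 𝕜) := by
    ext r z
    exact (RCLike.real_smul_eq_coe_mul r z).symm
  unfold gint
  rw [this]

variable [TopologicalSpace G] [BorelSpace G]

theorem gint_swap [IsFiniteMeasureOnCompacts μ] {f : G → G → X} (hf : Continuous f.uncurry)
    (hc : HasCompactSupport f.uncurry) :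
    gint 𝕜 μ (fun s => gint 𝕜 μ (fun r => f s r)) =
      gint 𝕜 μ (fun r => gint 𝕜 μ (fun s => f s r)) := by
  letI : NormedSpace ℝ X := NormedSpace.restrictScalars ℝ 𝕜 X
  exact integral_integral_swap_of_hasCompactSupport hf hc

variable [Group G] [IsTopologicalGroup G]

theorem gint_mul_left [μ.IsMulLeftInvariant] (g : G) (f : G → X) :
    gint 𝕜 μ (fun s => f (g * s)) = gint 𝕜 μ f := by
  letI : NormedSpace ℝ X := NormedSpace.restrictScalars ℝ 𝕜 X
  exact integral_mul_left_eq_self f g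

theorem continuous_gint [LocallyCompactSpace G] [IsFiniteMeasureOnCompacts μ] {f : G → G → X}
    (hf : Continuous f.uncurry) {k : Set G} (hk : IsCompact k) (h : ∀ p x, x ∉ k → f p x = 0) :
    Continuous (fun p => gint 𝕜 μ (f p)) := by
  letI : NormedSpace ℝ X := NormedSpace.restrictScalars ℝ 𝕜 X
  rw [← continuousOn_univ]
  exact continuousOn_integral_of_compact_support hk hf.continuousOn (fun p x _ hx => h p x hx)

end Integral

/-! ### Strongly continuous group representations are jointly continuous -/

section Joint

variable {𝕜 : Type*} [RCLike 𝕜] {G : Type*} [Group G] [TopologicalSpace G]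
  {X : Type*} [NormedAddCommGroup X] [NormedSpace 𝕜 X] [CompleteSpace X]

theorem bdd_on_compact {U : G → (X →L[𝕜] X)} (hU : ∀ x, Continuous fun s => U s x)
    {K : Set G} (hK : IsCompact K) : ∃ C, ∀ s ∈ K, ‖U s‖ ≤ C := by
  obtain ⟨C, hC⟩ := banach_steinhaus (g := fun s : K => U s) (fun x => by
    obtain ⟨C, hC⟩ := hK.exists_bound_of_continuousOn (hU x).continuousOn
    exact ⟨C, fun i => hC i i.2⟩)
  exact ⟨C, fun s hs => hC ⟨s, hs⟩⟩

theorem joint_continuous [LocallyCompactSpace G] {U : G → (X →L[𝕜] X)}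
    (hU : ∀ x, Continuous fun s => U s x) : Continuous fun p : G × X => U p.1 p.2 := by
  rw [continuous_iff_continuousAt]
  rintro ⟨r, x⟩
  obtain ⟨K, hK, hKr⟩ := exists_compact_mem_nhds r
  obtain ⟨C, hC⟩ := bdd_on_compact hU hK
  have h1 : Tendsto (fun p : G × X => U p.1 (p.2 - x)) (𝓝 (r, x)) (𝓝 0) := by
    apply squeeze_zero_norm' (a := fun p : G × X => C * ‖p.2 - x‖)
    · have : ∀ᶠ p : G × X in 𝓝 (r, x), p.1 ∈ K := continuous_fst.continuousAt.eventually hKr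
      filter_upwards [this] with p hp
      exact ((U p.1).le_opNorm _).trans (by gcongr; exact hC _ hp)
    · have : Continuous fun p : G × X => C * ‖p.2 - x‖ := by fun_prop
      simpa using this.tendsto (r, x)
  have h2 : Tendsto (fun p : G × X => U p.1 x) (𝓝 (r, x)) (𝓝 (U r x)) :=
    ((hU x).comp continuous_fst).tendsto (r, x)
  have := h1.add h2
  simpa [ContinuousAt] using this

end Joint

/-! ### Banach algebra dynamical systems and covariant representations -/

/-- A dynamical system `(A, G, α)`: `α` is a strongly continuous action of `G` on `A` by bounded
algebra automorphisms (a homomorphism from a group into the monoid `A →L[𝕜] A` automatically has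
invertible values). -/
structure DynSys (𝕜 G A : Type*) [RCLike 𝕜] [Group G] [TopologicalSpace G]
    [NonUnitalNormedRing A] [NormedSpace 𝕜 A] where
  /-- the action -/
  act : G →* (A →L[𝕜] A)
  act_mul : ∀ (s : G) (a b : A), act s (a * b) = act s a * act s b
  act_cont : ∀ a : A, Continuous fun s => act s a

section Covariant

variable {𝕜 G A : Type*} [RCLike 𝕜] [Group G] [TopologicalSpace G]
  [NonUnitalNormedRing A] [NormedSpace 𝕜 A]

/-- A continuous covariant representation `(π, U)` of `(A, G, α)` on `X`. -/
structure ContCovRep (α : DynSys 𝕜 G A) (X : Type*) [NormedAddCommGroup X] [NormedSpace 𝕜 X] where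
  /-- the representation of the algebra -/
  π : A →ₙₐ[𝕜] (X →L[𝕜] X)
  /-- the representation of the group (its values are automatically invertible) -/
  U : G →* (X →L[𝕜] X)
  covariant : ∀ (a : A) (s : G), π (α.act s a) = U s * π a * U s⁻¹
  bounded : ∃ C : ℝ, ∀ a : A, ‖π a‖ ≤ C * ‖a‖
  strongCont : ∀ x : X, Continuous fun s => U s x

namespace ContCovRep

variable {α : DynSys 𝕜 G A} {X : Type*} [NormedAddCommGroup X] [NormedSpace 𝕜 X]
  {Y : Type*} [NormedAddCommGroup Y] [NormedSpace 𝕜 Y]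

/-- Invariance of a subspace under both `π(A)` and `U(G)`. -/
def Invariant (ρ : ContCovRep α X) (Z : Submodule 𝕜 X) : Prop :=
  RepInvariant ρ.π Z ∧ ∀ (r : G), ∀ x ∈ Z, ρ.U r x ∈ Z

/-- `Φ` intertwines both the algebra representations and the group representations. -/
def Intertwines (ρ : ContCovRep α X) (τ : ContCovRep α Y) (Φ : X →L[𝕜] Y) : Prop :=
  RepIntertwines ρ.π τ.π Φ ∧ ∀ r : G, τ.U r ∘L Φ = Φ ∘L ρ.U r

/-- `(π, U)` is involutive: the norm of `X` comes from an inner product for which `π` is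
involutive and each (invertible) `U r` is unitary. -/
def Involutive [Star A] (ρ : ContCovRep α X) : Prop :=
  ∃ H : InnerProductSpace 𝕜 X, H.toNormedSpace = ‹NormedSpace 𝕜 X› ∧
    (∀ (a : A) (x y : X), H.inner (ρ.π a x) y = H.inner x (ρ.π (star a) y)) ∧
    ∀ (r : G) (x y : X), H.inner (ρ.U r x) (ρ.U r y) = H.inner x y

/-- `a ↦ π(a)` as a bounded operator. -/
def πL (ρ : ContCovRep α X) : A →L[𝕜] (X →L[𝕜] X) :=
  LinearMap.mkContinuousOfExistsBound
    { toFun := fun a => ρ.π a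
      map_add' := fun a b => map_add ρ.π a b
      map_smul' := fun c a => map_smul ρ.π c a } ρ.bounded

@[simp] theorem πL_apply (ρ : ContCovRep α X) (a : A) : ρ.πL a = ρ.π a := rfl

theorem U_inv_apply (ρ : ContCovRep α X) (r : G) (x : X) : ρ.U r⁻¹ (ρ.U r x) = x := by
  have : ρ.U r⁻¹ * ρ.U r = 1 := by rw [← map_mul]; simp
  exact congrArg (fun T : X →L[𝕜] X => T x) this

theorem U_mul_apply (ρ : ContCovRep α X) (r s : G) (x : X) :
    ρ.U (r * s) x = ρ.U r (ρ.U s x) := by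
  rw [map_mul]; rfl

theorem cov_apply (ρ : ContCovRep α X) (a : A) (s : G) (x : X) :
    ρ.π (α.act s a) (ρ.U s x) = ρ.U s (ρ.π a x) := by
  rw [ρ.covariant]
  simp [U_inv_apply]

variable [MeasurableSpace G] (μ : Measure G)

/-- The integrand `s ↦ π(f(s)) U_s x` of the integrated form. -/
def integrand (ρ : ContCovRep α X) (f : C_c(G, A)) (x : X) (s : G) : X := ρ.π (f s) (ρ.U s x)

theorem continuous_integrand (ρ : ContCovRep α X) (f : C_c(G, A)) (x : X) :
    Continuous (ρ.integrand f x) :=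
  (ρ.πL.continuous.comp f.continuous).clm_apply (ρ.strongCont x)

theorem compact_integrand (ρ : ContCovRep α X) (f : C_c(G, A)) (x : X) :
    HasCompactSupport (ρ.integrand f x) :=
  f.hasCompactSupport.mono fun s hs => by
    contrapose! hs
    simp only [Function.mem_support, not_not] at hs
    simp [integrand, hs]

variable [BorelSpace G] [IsFiniteMeasureOnCompacts μ]

theorem integrable_integrand (ρ : ContCovRep α X) (f : C_c(G, A)) (x : X) :
    Integrable (ρ.integrand f x) μ :=
  (ρ.continuous_integrand f x).integrable_of_hasCompactSupport (ρ.compact_integrand f x)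

theorem norm_gint_integrand_le (ρ : ContCovRep α X) (f : C_c(G, A)) (x : X) {C M : ℝ}
    (hC : ∀ a, ‖ρ.π a‖ ≤ C * ‖a‖) (hC0 : 0 ≤ C) (hM : ∀ s ∈ tsupport f, ‖ρ.U s‖ ≤ M) :
    ‖gint 𝕜 μ (ρ.integrand f x)‖ ≤ C * M * (∫ s, ‖f s‖ ∂μ) * ‖x‖ := by
  have hi : Integrable (fun s => ‖f s‖) μ :=
    (f.continuous.integrable_of_hasCompactSupport f.hasCompactSupport).norm
  calc ‖gint 𝕜 μ (ρ.integrand f x)‖ ≤ ∫ s, ‖ρ.integrand f x s‖ ∂μ := norm_gint_le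
    _ ≤ ∫ s, (C * M * ‖x‖) * ‖f s‖ ∂μ := by
        apply integral_mono (ρ.integrable_integrand μ f x).norm (hi.const_mul _)
        intro s
        by_cases hs : s ∈ tsupport f
        · calc ‖ρ.π (f s) (ρ.U s x)‖ ≤ ‖ρ.π (f s)‖ * (‖ρ.U s‖ * ‖x‖) :=
                ((ρ.π (f s)).le_opNorm _).trans (by gcongr; exact (ρ.U s).le_opNorm _)
            _ ≤ (C * ‖f s‖) * (M * ‖x‖) := by
                gcongr
                · exact hC _
                · exact hM s hs
            _ = (C * M * ‖x‖) * ‖f s‖ := by ring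
        · have : f s = 0 := image_eq_zero_of_notMem_tsupport hs
          simp [integrand, this]
    _ = C * M * (∫ s, ‖f s‖ ∂μ) * ‖x‖ := by rw [integral_const_mul]; ring

variable [CompleteSpace X]

/-- The integrated form `(π ⋊ U)(f) = ∫ π(f(s)) U_s ds`, the integral being taken pointwise on
`X`. -/
def integrated (ρ : ContCovRep α X) (f : C_c(G, A)) : X →L[𝕜] X :=
  LinearMap.mkContinuousOfExistsBound
    { toFun := fun x => gint 𝕜 μ (fun s => ρ.π (f s) (ρ.U s x))
      map_add' := fun x y => by
        refine Eq.trans ?_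
          (gint_add (ρ.integrable_integrand μ f x) (ρ.integrable_integrand μ f y))
        simp
      map_smul' := fun c x => by
        simp only [RingHom.id_apply, ← gint_smul, map_smul] }
    (by
      obtain ⟨C, hC⟩ := ρ.bounded
      obtain ⟨M, hM⟩ := bdd_on_compact ρ.strongCont f.hasCompactSupport
      refine ⟨|C| * M * (∫ s, ‖f s‖ ∂μ), fun x => ?_⟩
      exact ρ.norm_gint_integrand_le μ f x
        (fun a => (hC a).trans (by gcongr; exact le_abs_self C)) (abs_nonneg C) hM)

theorem integrated_apply (ρ : ContCovRep α X) (f : C_c(G, A)) (x : X) :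
    ρ.integrated μ f x = gint 𝕜 μ (fun s => ρ.π (f s) (ρ.U s x)) := rfl

theorem integrated_add (ρ : ContCovRep α X) (f g : C_c(G, A)) :
    ρ.integrated μ (f + g) = ρ.integrated μ f + ρ.integrated μ g := by
  ext x
  simp only [integrated_apply, add_apply]
  refine Eq.trans ?_ (gint_add (ρ.integrable_integrand μ f x) (ρ.integrable_integrand μ g x))
  simp

theorem integrated_smul (ρ : ContCovRep α X) (c : 𝕜) (f : C_c(G, A)) :
    ρ.integrated μ (c • f) = c • ρ.integrated μ f := by
  ext x
  simp only [integrated_apply, smul_apply, ← gint_smul]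
  simp

end ContCovRep

end Covariant

/-! ### Twisted convolution -/

section Convolution

variable {𝕜 G A : Type*} [RCLike 𝕜] [Group G] [TopologicalSpace G] [IsTopologicalGroup G]
  [T2Space G] [LocallyCompactSpace G] [MeasurableSpace G] [BorelSpace G]
  [NonUnitalNormedRing A] [NormedSpace 𝕜 A] [CompleteSpace A]
  [IsScalarTower 𝕜 A A] [SMulCommClass 𝕜 A A]
  (μ : Measure G) [μ.IsHaarMeasure] (α : DynSys 𝕜 G A)

theorem continuous_convIntegrand (f g : C_c(G, A)) :
    Continuous (fun p : G × G => f p.2 * α.act p.2 (g (p.2⁻¹ * p.1))) := by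
  have h := joint_continuous α.act_cont
  have h2 : Continuous (fun p : G × G => (p.2, g (p.2⁻¹ * p.1))) := by
    have := g.continuous
    fun_prop
  exact (f.continuous.comp continuous_snd).mul (h.comp h2)

theorem conv_support (f g : C_c(G, A)) (s r : G) (h : f r * α.act r (g (r⁻¹ * s)) ≠ 0) :
    r ∈ tsupport f ∧ r⁻¹ * s ∈ tsupport g := by
  constructor
  · refine subset_tsupport _ fun h0 => h ?_
    rw [h0, zero_mul]
  · refine subset_tsupport _ fun h0 => h ?_
    rw [h0, map_zero, mul_zero]

/-- The twisted convolution `(f * g)(s) = ∫ f(r) α_r(g(r⁻¹ s)) dr` on `C_c(G, A)`. -/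
def conv (f g : C_c(G, A)) : C_c(G, A) where
  toFun s := gint 𝕜 μ (fun r => f r * α.act r (g (r⁻¹ * s)))
  continuous_toFun := by
    apply continuous_gint (continuous_convIntegrand α f g) f.hasCompactSupport
    intro s r hr
    by_contra h
    exact hr (conv_support α f g s r h).1
  hasCompactSupport' := by
    apply HasCompactSupport.of_support_subset_isCompact
      (f.hasCompactSupport.isCompact.mul g.hasCompactSupport.isCompact)
    intro s hs
    by_contra hns
    apply hs
    have : (fun r => f r * α.act r (g (r⁻¹ * s))) = fun _ => (0 : A) := by
      funext r
      by_contra h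
      obtain ⟨h1, h2⟩ := conv_support α f g s r h
      exact hns ⟨r, h1, r⁻¹ * s, h2, by simp⟩
    change gint 𝕜 μ (fun r => f r * α.act r (g (r⁻¹ * s))) = 0
    rw [this]
    simp [gint]

theorem conv_apply (f g : C_c(G, A)) (s : G) :
    conv μ α f g s = gint 𝕜 μ (fun r => f r * α.act r (g (r⁻¹ * s))) := rfl

theorem integrable_convIntegrand (f g : C_c(G, A)) (s : G) :
    Integrable (fun r => f r * α.act r (g (r⁻¹ * s))) μ := by
  apply Continuous.integrable_of_hasCompactSupport
  · exact (continuous_convIntegrand α f g).comp (Continuous.prodMk_right s)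
  · apply f.hasCompactSupport.mono'
    intro r hr
    exact (conv_support α f g s r hr).1

theorem conv_add (f g h : C_c(G, A)) : conv μ α f (g + h) = conv μ α f g + conv μ α f h := by
  ext s
  rw [CompactlySupportedContinuousMap.add_apply, conv_apply, conv_apply, conv_apply,
    ← gint_add (integrable_convIntegrand μ α f g s) (integrable_convIntegrand μ α f h s)]
  simp [mul_add]

theorem add_conv (f g h : C_c(G, A)) : conv μ α (f + g) h = conv μ α f h + conv μ α g h := by
  ext s
  rw [CompactlySupportedContinuousMap.add_apply, conv_apply, conv_apply, conv_apply,
    ← gint_add (integrable_convIntegrand μ α f h s) (integrable_convIntegrand μ α g h s)]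
  simp [add_mul]

theorem smul_conv (c : 𝕜) (f g : C_c(G, A)) : conv μ α (c • f) g = c • conv μ α f g := by
  ext s
  rw [CompactlySupportedContinuousMap.smul_apply, conv_apply, conv_apply, ← gint_smul]
  simp [smul_mul_assoc]

theorem conv_smul (c : 𝕜) (f g : C_c(G, A)) : conv μ α f (c • g) = c • conv μ α f g := by
  ext s
  rw [CompactlySupportedContinuousMap.smul_apply, conv_apply, conv_apply, ← gint_smul]
  simp [mul_smul_comm]

variable {α}

/-- The integrated form is multiplicative for the twisted convolution. -/
theorem ContCovRep.integrated_conv {X : Type*} [NormedAddCommGroup X] [NormedSpace 𝕜 X]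
    [CompleteSpace X] (ρ : ContCovRep α X) (f g : C_c(G, A)) :
    ρ.integrated μ (conv μ α f g) = ρ.integrated μ f * ρ.integrated μ g := by
  ext x
  set F : G → G → X := fun s r => ρ.π (f r) (ρ.U r (ρ.π (g (r⁻¹ * s)) (ρ.U (r⁻¹ * s) x))) with hF
  have key : ∀ s r, ρ.π (f r * α.act r (g (r⁻¹ * s))) (ρ.U s x) = F s r := by
    intro s r
    rw [map_mul, mul_apply_eq_comp]
    have h1 : ρ.U s x = ρ.U r (ρ.U (r⁻¹ * s) x) := by
      rw [← ρ.U_mul_apply]; simp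
    rw [h1, ρ.cov_apply]
  have hJ := joint_continuous ρ.strongCont
  have hcont : Continuous F.uncurry := by
    have h1 : Continuous fun p : G × G => ρ.integrand g x (p.2⁻¹ * p.1) :=
      (ρ.continuous_integrand g x).comp (by fun_prop)
    have h2 : Continuous fun p : G × G => ρ.U p.2 (ρ.integrand g x (p.2⁻¹ * p.1)) :=
      hJ.comp (continuous_snd.prodMk h1)
    exact ((ρ.πL.continuous.comp f.continuous).comp continuous_snd).clm_apply h2
  have hcomp : HasCompactSupport F.uncurry := by
    apply HasCompactSupport.of_support_subset_isCompact
      ((f.hasCompactSupport.isCompact.mul g.hasCompactSupport.isCompact).prod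
        f.hasCompactSupport.isCompact)
    rintro ⟨s, r⟩ hsr
    have h0 : f r * α.act r (g (r⁻¹ * s)) ≠ 0 := by
      intro h0
      apply hsr
      change F s r = 0
      rw [← key, h0]
      simp
    obtain ⟨h1, h2⟩ := conv_support α f g s r h0
    exact ⟨⟨r, h1, r⁻¹ * s, h2, by simp⟩, h1⟩
  calc ρ.integrated μ (conv μ α f g) x
      = gint 𝕜 μ (fun s => gint 𝕜 μ (fun r => F s r)) := by
        rw [ρ.integrated_apply μ]
        congr 1
        funext s
        have := gint_comm (𝕜 := 𝕜) (ρ.πL.flip (ρ.U s x)) (integrable_convIntegrand μ α f g s)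
        simp only [ContinuousLinearMap.flip_apply, ContCovRep.πL_apply, key] at this
        rw [this]
        rfl
    _ = gint 𝕜 μ (fun r => gint 𝕜 μ (fun s => F s r)) := gint_swap hcont hcomp
    _ = gint 𝕜 μ (fun r => ρ.π (f r) (ρ.U r (ρ.integrated μ g x))) := by
        congr 1
        funext r
        rw [ρ.integrated_apply μ,
          ← gint_mul_left (μ := μ) r⁻¹ (fun s => ρ.π (g s) (ρ.U s x))]
        have hi : Integrable (fun s => ρ.integrand g x (r⁻¹ * s)) μ :=
          (ρ.integrable_integrand μ g x).comp_mul_left r⁻¹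
        exact gint_comm (𝕜 := 𝕜) (ρ.π (f r) ∘L ρ.U r) hi
    _ = (ρ.integrated μ f * ρ.integrated μ g) x := by
        rw [mul_apply_eq_comp, ρ.integrated_apply μ f]

end Convolution

/-! ### The modular function and the involution of `C_c(G, A)` -/

section Modular

variable {G : Type*} [Group G] [TopologicalSpace G] [IsTopologicalGroup G] [LocallyCompactSpace G]

/-- The modular function `Δ`, normalised by `Δ(r) ∫ f(s r) ds = ∫ f(s) ds`
for left Haar integrals. -/
def modularFn (r : G) : ℝ := ((Measure.modularCharacter r : ℝ≥0) : ℝ)⁻¹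

theorem modularFn_pos (r : G) : 0 < modularFn r :=
  inv_pos.2 (NNReal.coe_pos.2 (Measure.modularCharacterFun_pos r))

theorem modularFn_integral [MeasurableSpace G] [BorelSpace G] (μ : Measure G) [μ.IsHaarMeasure]
    (r : G) {f : G → ℝ}
    (hf : Continuous f) (hc : HasCompactSupport f) :
    modularFn r * ∫ s, f (s * r) ∂μ = ∫ s, f s ∂μ := by
  have h0 : (Measure.modularCharacter r : ℝ≥0) ≠ 0 := (Measure.modularCharacterFun_pos r).ne'
  have h1 : ∫ s, f (s * r) ∂μ = ∫ s, f s ∂(Measure.map (· * r) μ) :=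
    (integral_map_equiv (MeasurableEquiv.mulRight r) f).symm
  have h2 := Measure.integral_isMulLeftInvariant_eq_smul_of_hasCompactSupport
    (Measure.map (· * r) μ) μ hf hc
  rw [h1, h2, ← Measure.modularCharacterFun_eq_haarScalarFactor μ r,
    integral_smul_nnreal_measure, modularFn, NNReal.smul_def, smul_eq_mul, ← mul_assoc]
  change ((Measure.modularCharacter r : ℝ≥0) : ℝ)⁻¹ * ((Measure.modularCharacter r : ℝ≥0) : ℝ) * _
    = _
  rw [inv_mul_cancel₀ (NNReal.coe_ne_zero.2 h0), one_mul]

theorem continuous_modularFn : Continuous (modularFn : G → ℝ) := by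
  borelize G
  let μ := Measure.haar (G := G)
  obtain ⟨⟨f, hf⟩, hc, h0, h1⟩ : ∃ f : C(G, ℝ), HasCompactSupport f ∧ 0 ≤ f ∧ f 1 ≠ 0 :=
    exists_continuous_nonneg_pos 1
  have hI : 0 < ∫ s, f s ∂μ :=
    hf.integral_pos_of_hasCompactSupport_nonneg_nonzero hc h0 h1
  have hcont : Continuous fun r : G => ∫ s, f (s * r) ∂μ := by
    rw [continuous_iff_continuousAt]
    intro r
    obtain ⟨K, hK, hKr⟩ := exists_compact_mem_nhds r
    refine ContinuousOn.continuousAt (s := K) ?_ hKr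
    refine continuousOn_integral_of_compact_support
      (hc.isCompact.mul hK.inv) (by fun_prop) fun p x hp hx => ?_
    by_contra h
    exact hx ⟨x * p, subset_tsupport _ h, p⁻¹, by simpa using hp, by simp⟩
  have hne : ∀ r : G, ∫ s, f (s * r) ∂μ ≠ 0 := fun r h => by
    have := modularFn_integral μ r hf hc
    rw [h, mul_zero] at this
    exact hI.ne this
  have : (modularFn : G → ℝ) = fun r => (∫ s, f s ∂μ) / ∫ s, f (s * r) ∂μ := by
    funext r
    rw [eq_div_iff (hne r)]
    exact modularFn_integral μ r hf hc
  rw [this]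
  exact continuous_const.div hcont hne

theorem modularFn_mul (r s : G) : modularFn (r * s) = modularFn r * modularFn s := by
  simp [modularFn, map_mul, mul_comm]

theorem modularFn_inv (r : G) : modularFn r⁻¹ = (modularFn r)⁻¹ := by
  have : modularFn r * modularFn r⁻¹ = 1 := by
    rw [← modularFn_mul]
    simp [modularFn]
  exact eq_inv_of_mul_eq_one_right this

/-- `∫ Δ(s⁻¹) f(s⁻¹) ds = ∫ f(s) ds`. -/
theorem integral_modularFn_inv [MeasurableSpace G] [BorelSpace G] (μ : Measure G)
    [μ.IsHaarMeasure] {E : Type*} [NormedAddCommGroup E] [NormedSpace ℝ E]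
    [CompleteSpace E] {f : G → E} (hf : Continuous f) (hc : HasCompactSupport f) :
    ∫ s, modularFn s⁻¹ • f s⁻¹ ∂μ = ∫ s, f s ∂μ := by
  obtain ⟨⟨h, hh⟩, hhc, h0, h1⟩ : ∃ f : C(G, ℝ), HasCompactSupport f ∧ 0 ≤ f ∧ f 1 ≠ 0 :=
    exists_continuous_nonneg_pos 1
  change Continuous h at hh
  change HasCompactSupport h at hhc
  have hI : 0 < ∫ s, h s ∂μ :=
    hh.integral_pos_of_hasCompactSupport_nonneg_nonzero hhc h0 h1
  have e1 : ∀ s, (∫ t, h t ∂μ) • (modularFn s⁻¹ • f s⁻¹) = ∫ t, h (t * s) • f s⁻¹ ∂μ := by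
    intro s
    rw [integral_smul_const, ← modularFn_integral μ s hh hhc, smul_smul,
      modularFn_inv]
    congr 1
    field_simp [(modularFn_pos s).ne']
  have sw1 : ∫ s, ∫ t, h (t * s) • f s⁻¹ ∂μ ∂μ = ∫ t, ∫ s, h (t * s) • f s⁻¹ ∂μ ∂μ := by
    refine integral_integral_swap_of_hasCompactSupport (f := fun s t => h (t * s) • f s⁻¹)
      (by simp only [Function.uncurry_def]; fun_prop) ?_
    apply HasCompactSupport.of_support_subset_isCompact
      (hc.isCompact.inv.prod (hhc.isCompact.mul hc.isCompact))
    rintro ⟨s, t⟩ hst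
    have hst' : h (t * s) • f s⁻¹ ≠ 0 := hst
    have a1 : s⁻¹ ∈ tsupport f := subset_tsupport _ fun z => hst' (by rw [z, smul_zero])
    have a2 : t * s ∈ tsupport h := subset_tsupport _ fun z => hst' (by rw [z, zero_smul])
    exact ⟨by simpa using a1, t * s, a2, s⁻¹, a1, by simp⟩
  have sw2 : ∫ t, ∫ s, h s • f (s⁻¹ * t) ∂μ ∂μ = ∫ s, ∫ t, h s • f (s⁻¹ * t) ∂μ ∂μ := by
    refine integral_integral_swap_of_hasCompactSupport (f := fun t s => h s • f (s⁻¹ * t))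
      (by simp only [Function.uncurry_def]; fun_prop) ?_
    apply HasCompactSupport.of_support_subset_isCompact
      ((hhc.isCompact.mul hc.isCompact).prod hhc.isCompact)
    rintro ⟨t, s⟩ hst
    have hst' : h s • f (s⁻¹ * t) ≠ 0 := hst
    have a1 : s⁻¹ * t ∈ tsupport f := subset_tsupport _ fun z => hst' (by rw [z, smul_zero])
    have a2 : s ∈ tsupport h := subset_tsupport _ fun z => hst' (by rw [z, zero_smul])
    exact ⟨⟨s, a2, s⁻¹ * t, a1, by simp⟩, a2⟩
  have e2 : (∫ t, h t ∂μ) • ∫ s, modularFn s⁻¹ • f s⁻¹ ∂μ = (∫ t, h t ∂μ) • ∫ s, f s ∂μ := by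
    calc (∫ t, h t ∂μ) • ∫ s, modularFn s⁻¹ • f s⁻¹ ∂μ
        = ∫ s, ∫ t, h (t * s) • f s⁻¹ ∂μ ∂μ := by
          rw [← integral_smul]
          exact integral_congr_ae (Eventually.of_forall e1)
      _ = ∫ t, ∫ s, h (t * s) • f s⁻¹ ∂μ ∂μ := sw1
      _ = ∫ t, ∫ s, h s • f (s⁻¹ * t) ∂μ ∂μ := by
          congr 1
          funext t
          rw [← integral_mul_left_eq_self _ t⁻¹]
          simp
      _ = ∫ s, ∫ t, h s • f (s⁻¹ * t) ∂μ ∂μ := sw2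
      _ = ∫ s, h s • ∫ t, f t ∂μ ∂μ := by
          congr 1
          funext s
          rw [integral_smul, integral_mul_left_eq_self f s⁻¹]
      _ = (∫ t, h t ∂μ) • ∫ s, f s ∂μ := integral_smul_const _ _
  exact smul_right_injective E hI.ne' e2

end Modular

section Involution

variable {𝕜 G A : Type*} [RCLike 𝕜] [Group G] [TopologicalSpace G] [IsTopologicalGroup G]
  [T2Space G] [LocallyCompactSpace G]
  [NonUnitalNormedRing A] [NormedSpace 𝕜 A] [CompleteSpace A]
  [StarRing A] [StarModule 𝕜 A] [ContinuousStar A] (α : DynSys 𝕜 G A)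

/-- The dynamical system is involutive: each `α_s` commutes with the involution. (That the
involution is bounded is the instance `ContinuousStar A`.) -/
def DynSys.Involutive : Prop := ∀ (s : G) (a : A), α.act s (star a) = star (α.act s a)

/-- `f^*(s) = Δ(s⁻¹) α_s(f(s⁻¹)^*)`. -/
def invol (f : C_c(G, A)) : C_c(G, A) where
  toFun s := ((modularFn s⁻¹ : ℝ) : 𝕜) • α.act s (star (f s⁻¹))
  continuous_toFun := by
    have h1 : Continuous fun s : G => ((modularFn s⁻¹ : ℝ) : 𝕜) :=
      RCLike.continuous_ofReal.comp (continuous_modularFn.comp continuous_inv)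
    have h2 : Continuous fun s : G => (s, star (f s⁻¹)) := by
      have := f.continuous
      fun_prop
    exact h1.smul ((joint_continuous α.act_cont).comp h2)
  hasCompactSupport' := by
    apply HasCompactSupport.of_support_subset_isCompact f.hasCompactSupport.isCompact.inv
    intro s hs
    have : s⁻¹ ∈ tsupport f := subset_tsupport _ fun z => hs (by simp [z])
    simpa using this

theorem invol_apply (f : C_c(G, A)) (s : G) :
    invol α f s = ((modularFn s⁻¹ : ℝ) : 𝕜) • α.act s (star (f s⁻¹)) := rfl

theorem invol_add (f g : C_c(G, A)) : invol α (f + g) = invol α f + invol α g := by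
  ext s
  simp [invol_apply]

theorem invol_smul (c : 𝕜) (f : C_c(G, A)) :
    invol α (c • f) = (starRingEnd 𝕜) c • invol α f := by
  ext s
  simp [invol_apply, star_smul, smul_smul, mul_comm]

end Involution

/-! ### The crossed product -/

/-- A uniformly bounded class of continuous covariant representations on Banach spaces. -/
structure UnifBddClass {𝕜 G A : Type*} [RCLike 𝕜] [Group G] [TopologicalSpace G]
    [NonUnitalNormedRing A] [NormedSpace 𝕜 A] (α : DynSys 𝕜 G A) where
  /-- the members of the class on a given Banach space -/
  mem : ∀ X : BanachSp.{w} 𝕜, Set (ContCovRep α X)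
  bdd : ∃ (C : ℝ≥0) (ν : G → ℝ≥0), (∀ K : Set G, IsCompact K → BddAbove (ν '' K)) ∧
    ∀ (X : BanachSp.{w} 𝕜), ∀ ρ ∈ mem X,
      (∀ a : A, ‖ρ.π a‖ ≤ C * ‖a‖) ∧ ∀ r : G, ‖ρ.U r‖ ≤ ν r

section CrossedProduct

variable {𝕜 G A : Type*} [RCLike 𝕜] [Group G] [TopologicalSpace G] [IsTopologicalGroup G]
  [T2Space G] [LocallyCompactSpace G] [MeasurableSpace G] [BorelSpace G]
  [NonUnitalNormedRing A] [NormedSpace 𝕜 A] [CompleteSpace A]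
  [IsScalarTower 𝕜 A A] [SMulCommClass 𝕜 A A]
  (μ : Measure G) [μ.IsHaarMeasure] {α : DynSys 𝕜 G A} (R : UnifBddClass.{w} α)

/-- The seminorm `σ^R(f) = sup_{(π, U) ∈ R} ‖(π ⋊ U)(f)‖`. -/
def sigma (f : C_c(G, A)) : ℝ :=
  ⨆ ρ : (Σ X : BanachSp.{w} 𝕜, R.mem X), ‖ρ.2.1.integrated μ f‖

theorem sigma_bdd (f : C_c(G, A)) :
    BddAbove (range fun ρ : (Σ X : BanachSp.{w} 𝕜, R.mem X) => ‖ρ.2.1.integrated μ f‖) := by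
  obtain ⟨C, ν, hν, hR⟩ := R.bdd
  obtain ⟨M, hM⟩ := hν _ f.hasCompactSupport
  refine ⟨C * M * ∫ s, ‖f s‖ ∂μ, ?_⟩
  rintro _ ⟨⟨X, ρ, hρ⟩, rfl⟩
  obtain ⟨h1, h2⟩ := hR X ρ hρ
  have h0 : 0 ≤ ∫ s, ‖f s‖ ∂μ := integral_nonneg fun _ => norm_nonneg _
  refine ContinuousLinearMap.opNorm_le_bound _ (by positivity) fun x => ?_
  exact ρ.norm_gint_integrand_le μ f x h1 C.2 fun s hs =>
    (h2 s).trans (NNReal.coe_le_coe.2 (hM ⟨s, hs, rfl⟩))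

theorem norm_integrated_le_sigma {X : BanachSp.{w} 𝕜} {ρ : ContCovRep α X} (hρ : ρ ∈ R.mem X)
    (f : C_c(G, A)) : ‖ρ.integrated μ f‖ ≤ sigma μ R f :=
  le_ciSup (sigma_bdd μ R f) ⟨X, ρ, hρ⟩

theorem sigma_nonneg (f : C_c(G, A)) : 0 ≤ sigma μ R f :=
  Real.iSup_nonneg fun _ => norm_nonneg _

theorem sigma_le {f : C_c(G, A)} {C : ℝ} (hC : 0 ≤ C)
    (h : ∀ (X : BanachSp.{w} 𝕜), ∀ ρ ∈ R.mem X, ‖ρ.integrated μ f‖ ≤ C) : sigma μ R f ≤ C :=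
  Real.iSup_le (fun ρ => h ρ.1 ρ.2.1 ρ.2.2) hC

theorem sigma_add (f g : C_c(G, A)) : sigma μ R (f + g) ≤ sigma μ R f + sigma μ R g :=
  sigma_le μ R (add_nonneg (sigma_nonneg μ R f) (sigma_nonneg μ R g)) fun X ρ hρ => by
    rw [ρ.integrated_add μ]
    exact (norm_add_le _ _).trans (add_le_add (norm_integrated_le_sigma μ R hρ f)
      (norm_integrated_le_sigma μ R hρ g))

theorem sigma_smul_le (c : 𝕜) (f : C_c(G, A)) : sigma μ R (c • f) ≤ ‖c‖ * sigma μ R f :=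
  sigma_le μ R (mul_nonneg (norm_nonneg c) (sigma_nonneg μ R f)) fun X ρ hρ => by
    rw [ρ.integrated_smul μ, norm_smul]
    exact mul_le_mul_of_nonneg_left (norm_integrated_le_sigma μ R hρ f) (norm_nonneg c)

theorem sigma_conv (f g : C_c(G, A)) :
    sigma μ R (conv μ α f g) ≤ sigma μ R f * sigma μ R g :=
  sigma_le μ R (mul_nonneg (sigma_nonneg μ R f) (sigma_nonneg μ R g)) fun X ρ hρ => by
    rw [ρ.integrated_conv μ]
    exact (norm_mul_le _ _).trans (mul_le_mul (norm_integrated_le_sigma μ R hρ f)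
      (norm_integrated_le_sigma μ R hρ g) (norm_nonneg _) (sigma_nonneg μ R f))

theorem sigma_zero : sigma μ R (0 : C_c(G, A)) = 0 := by
  refine le_antisymm ?_ (sigma_nonneg μ R _)
  simpa using sigma_smul_le μ R (0 : 𝕜) (0 : C_c(G, A))

theorem sigma_neg (f : C_c(G, A)) : sigma μ R (-f) = sigma μ R f := by
  have h : ∀ f : C_c(G, A), sigma μ R (-f) ≤ sigma μ R f := fun f => by
    simpa using sigma_smul_le μ R (-1 : 𝕜) f
  exact le_antisymm (h f) (by simpa using h (-f))

/-- The space `C_c(G, A)`, to be equipped with the seminorm `σ^R` and the twisted convolution. -/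
def PreCrossed (_ : Measure G) (_ : UnifBddClass.{w} α) : Type _ := C_c(G, A)

instance : AddCommGroup (PreCrossed μ R) := inferInstanceAs (AddCommGroup C_c(G, A))

instance : Module 𝕜 (PreCrossed μ R) := inferInstanceAs (Module 𝕜 C_c(G, A))

/-- `σ^R` as a seminorm on the additive group `C_c(G, A)`. -/
def sigmaSeminorm : AddGroupSeminorm (PreCrossed μ R) where
  toFun f := sigma (A := A) μ R f
  map_zero' := sigma_zero μ R
  add_le' f g := sigma_add μ R f g
  neg' f := sigma_neg μ R f

instance : SeminormedAddCommGroup (PreCrossed μ R) :=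
  (sigmaSeminorm μ R).toSeminormedAddCommGroup

instance : NormedSpace 𝕜 (PreCrossed μ R) where
  norm_smul_le c f := sigma_smul_le μ R c f

theorem preCrossed_norm (f : PreCrossed μ R) : ‖f‖ = sigma (A := A) μ R f := rfl

/-- The crossed product `(A ⋊_α G)^R`: the Hausdorff completion of `C_c(G, A)` for `σ^R`, that is,
the completion of `C_c(G, A) / ker σ^R` in the norm induced by `σ^R`. -/
def CrossedProduct : Type _ := UniformSpace.Completion (PreCrossed μ R)

namespace CrossedProduct

instance : NormedAddCommGroup (CrossedProduct μ R) :=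
  inferInstanceAs (NormedAddCommGroup (UniformSpace.Completion (PreCrossed μ R)))

instance : NormedSpace 𝕜 (CrossedProduct μ R) :=
  inferInstanceAs (NormedSpace 𝕜 (UniformSpace.Completion (PreCrossed μ R)))

instance : CompleteSpace (CrossedProduct μ R) :=
  inferInstanceAs (CompleteSpace (UniformSpace.Completion (PreCrossed μ R)))

/-- The canonical map `q^R : C_c(G, A) → (A ⋊_α G)^R`. -/
def q : C_c(G, A) →ₗ[𝕜] CrossedProduct μ R :=
  (UniformSpace.Completion.toComplL (𝕜 := 𝕜) (E := PreCrossed μ R)).toLinearMap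

theorem norm_q (f : C_c(G, A)) : ‖q μ R f‖ = sigma μ R f :=
  UniformSpace.Completion.norm_coe (E := PreCrossed μ R) f

theorem denseRange_q : DenseRange (q μ R) :=
  UniformSpace.Completion.denseRange_coe (α := PreCrossed μ R)

variable {μ R} in
theorem induction {p : CrossedProduct μ R → Prop} (c : CrossedProduct μ R)
    (hc : IsClosed {c | p c}) (h : ∀ f : C_c(G, A), p (q μ R f)) : p c :=
  isClosed_property (denseRange_q μ R) hc h c

/-- The twisted convolution as a bilinear map into the completion. -/
def convBil : C_c(G, A) →ₗ[𝕜] C_c(G, A) →ₗ[𝕜] CrossedProduct μ R :=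
  LinearMap.mk₂ 𝕜 (fun f g => q μ R (conv μ α f g))
    (fun f g h => by rw [add_conv, map_add])
    (fun c f g => by rw [smul_conv, map_smul])
    (fun f g h => by rw [conv_add, map_add])
    (fun c f g => by rw [conv_smul, map_smul])

theorem convBil_apply (f g : C_c(G, A)) : convBil μ R f g = q μ R (conv μ α f g) := rfl

theorem norm_convBil_le (f g : C_c(G, A)) : ‖convBil μ R f g‖ ≤ sigma μ R f * ‖q μ R g‖ := by
  rw [convBil_apply, norm_q, norm_q]
  exact sigma_conv μ R f g

/-- Left multiplication by `q^R(f)`: the continuous extension of `q^R(g) ↦ q^R(f * g)`. -/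
def leftMul : C_c(G, A) →ₗ[𝕜] (CrossedProduct μ R →L[𝕜] CrossedProduct μ R) where
  toFun f := (convBil μ R f).extendOfNorm (q μ R)
  map_add' f g := by
    refine LinearMap.extendOfNorm_unique (denseRange_q μ R) _ (norm_convBil_le μ R (f + g)) _ ?_
    ext h
    simp [LinearMap.extendOfNorm_eq (denseRange_q μ R) ⟨_, norm_convBil_le μ R _⟩]
  map_smul' c f := by
    refine LinearMap.extendOfNorm_unique (denseRange_q μ R) _ (norm_convBil_le μ R (c • f)) _ ?_
    ext h
    simp [LinearMap.extendOfNorm_eq (denseRange_q μ R) ⟨_, norm_convBil_le μ R _⟩]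

theorem leftMul_q (f g : C_c(G, A)) : leftMul μ R f (q μ R g) = q μ R (conv μ α f g) :=
  LinearMap.extendOfNorm_eq (denseRange_q μ R) ⟨_, norm_convBil_le μ R f⟩ g

theorem norm_leftMul_le (f : C_c(G, A)) : ‖leftMul μ R f‖ ≤ 1 * ‖q μ R f‖ := by
  rw [one_mul, norm_q]
  exact LinearMap.opNorm_extendOfNorm_le (denseRange_q μ R) (sigma_nonneg μ R f)
    (norm_convBil_le μ R f)

/-- The multiplication of the crossed product: the continuous bilinear extension of
`(q^R(f), q^R(g)) ↦ q^R(f * g)`. -/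
def mulL : CrossedProduct μ R →L[𝕜] CrossedProduct μ R →L[𝕜] CrossedProduct μ R :=
  (leftMul μ R).extendOfNorm (q μ R)

instance : Mul (CrossedProduct μ R) := ⟨fun a b => mulL μ R a b⟩

theorem mul_def (a b : CrossedProduct μ R) : a * b = mulL μ R a b := rfl

theorem q_mul (f g : C_c(G, A)) : q μ R f * q μ R g = q μ R (conv μ α f g) := by
  rw [mul_def, mulL, LinearMap.extendOfNorm_eq (denseRange_q μ R) ⟨1, norm_leftMul_le μ R⟩,
    leftMul_q]

theorem norm_mul_le' (a b : CrossedProduct μ R) : ‖a * b‖ ≤ ‖a‖ * ‖b‖ := by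
  have h := LinearMap.norm_extendOfNorm_apply_le (denseRange_q μ R) 1 (norm_leftMul_le μ R) a
  rw [one_mul] at h
  exact ((mulL μ R a).le_opNorm b).trans (mul_le_mul_of_nonneg_right h (norm_nonneg b))

theorem q_assoc (f g h : C_c(G, A)) :
    q μ R (conv μ α (conv μ α f g) h) = q μ R (conv μ α f (conv μ α g h)) := by
  rw [← sub_eq_zero, ← map_sub, ← norm_eq_zero, norm_q]
  refine le_antisymm (sigma_le μ R le_rfl fun X ρ _ => ?_) (sigma_nonneg μ R _)
  rw [sub_eq_add_neg, ← neg_one_smul 𝕜 (conv μ α f (conv μ α g h)), ρ.integrated_add μ,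
    ρ.integrated_smul μ, ρ.integrated_conv μ, ρ.integrated_conv μ, ρ.integrated_conv μ,
    ρ.integrated_conv μ, mul_assoc]
  simp

theorem mul_assoc' (a b c : CrossedProduct μ R) : a * b * c = a * (b * c) := by
  simp only [mul_def]
  induction a using induction with
  | hc => exact isClosed_eq (by fun_prop) (by fun_prop)
  | h f =>
  induction b using induction with
  | hc => exact isClosed_eq (by fun_prop) (by fun_prop)
  | h g =>
  induction c using induction with
  | hc => exact isClosed_eq (by fun_prop) (by fun_prop)
  | h h => simp only [← mul_def, q_mul, q_assoc]

/-- The crossed product is a Banach algebra. -/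
instance : NonUnitalNormedRing (CrossedProduct μ R) :=
  { (inferInstance : NormedAddCommGroup (CrossedProduct μ R)),
    (inferInstance : Mul (CrossedProduct μ R)) with
    left_distrib := fun a b c => map_add (mulL μ R a) b c
    right_distrib := fun a b c => by simp [mul_def]
    zero_mul := fun a => by simp [mul_def]
    mul_zero := fun a => by simp [mul_def]
    mul_assoc := mul_assoc' μ R
    norm_mul_le := norm_mul_le' μ R }

instance : IsScalarTower 𝕜 (CrossedProduct μ R) (CrossedProduct μ R) where
  smul_assoc c a b := by
    change mulL μ R (c • a) b = c • mulL μ R a b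
    simp

instance : SMulCommClass 𝕜 (CrossedProduct μ R) (CrossedProduct μ R) where
  smul_comm c a b := by
    change c • mulL μ R a b = mulL μ R a (c • b)
    simp

end CrossedProduct

/-- The integrated form as a linear map on `C_c(G, A)`. -/
def ContCovRep.integratedLin {X : Type*} [NormedAddCommGroup X] [NormedSpace 𝕜 X]
    [CompleteSpace X] (ρ : ContCovRep α X) : C_c(G, A) →ₗ[𝕜] (X →L[𝕜] X) where
  toFun f := ρ.integrated μ f
  map_add' := ρ.integrated_add μ
  map_smul' := ρ.integrated_smul μ

variable {R}

theorem norm_integratedLin_le {X : BanachSp.{w} 𝕜} {ρ : ContCovRep α X} (hρ : ρ ∈ R.mem X)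
    (f : C_c(G, A)) : ‖ρ.integratedLin μ f‖ ≤ 1 * ‖CrossedProduct.q μ R f‖ := by
  rw [one_mul, CrossedProduct.norm_q]
  exact norm_integrated_le_sigma μ R hρ f

theorem extend_integratedLin_q {X : BanachSp.{w} 𝕜} {ρ : ContCovRep α X} (hρ : ρ ∈ R.mem X)
    (f : C_c(G, A)) : (ρ.integratedLin μ).extendOfNorm (CrossedProduct.q μ R)
      (CrossedProduct.q μ R f) = ρ.integrated μ f :=
  LinearMap.extendOfNorm_eq (CrossedProduct.denseRange_q μ R)
    ⟨1, norm_integratedLin_le μ hρ⟩ f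

/-- For `(π, U) ∈ R`, the representation `(π ⋊ U)^R` of the crossed product: the continuous
extension of `q^R(f) ↦ (π ⋊ U)(f)`. -/
def integratedRep {X : BanachSp.{w} 𝕜} (ρ : R.mem X) :
    CrossedProduct μ R →ₙₐ[𝕜] (X →L[𝕜] X) where
  toFun c := (ρ.1.integratedLin μ).extendOfNorm (CrossedProduct.q μ R) c
  map_smul' k c := map_smul _ k c
  map_zero' := map_zero _
  map_add' c d := map_add _ c d
  map_mul' c d := by
    set E := (ρ.1.integratedLin μ).extendOfNorm (CrossedProduct.q μ R)
    simp only [CrossedProduct.mul_def]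
    induction c using CrossedProduct.induction with
    | hc => exact isClosed_eq (by fun_prop) (by fun_prop)
    | h f =>
    induction d using CrossedProduct.induction with
    | hc => exact isClosed_eq (by fun_prop) (by fun_prop)
    | h g =>
    rw [← CrossedProduct.mul_def, CrossedProduct.q_mul, extend_integratedLin_q μ ρ.2,
      extend_integratedLin_q μ ρ.2, extend_integratedLin_q μ ρ.2, ρ.1.integrated_conv μ]

/-- `(π ⋊ U)^R(q^R(f)) = (π ⋊ U)(f)`. -/
theorem integratedRep_q {X : BanachSp.{w} 𝕜} (ρ : R.mem X) (f : C_c(G, A)) :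
    integratedRep μ ρ (CrossedProduct.q μ R f) = ρ.1.integrated μ f :=
  extend_integratedLin_q μ ρ.2 f

section Star

variable (R) [StarRing A] [StarModule 𝕜 A] [ContinuousStar A]

/-- `f ↦ q^R(f^*)`, a conjugate-linear map. -/
def involLin : C_c(G, A) →ₛₗ[starRingEnd 𝕜] CrossedProduct μ R where
  toFun f := CrossedProduct.q μ R (invol α f)
  map_add' f g := by rw [invol_add, map_add]
  map_smul' c f := by rw [invol_smul, map_smul]

/-- The involution of the crossed product: the continuous conjugate-linear extension of
`q^R(f) ↦ q^R(f^*)`. It exists, and is isometric, if `(A, G, α)` and `R` are involutive. -/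
def CrossedProduct.invol (c : CrossedProduct μ R) : CrossedProduct μ R :=
  (involLin μ R).extendOfNorm (CrossedProduct.q μ R) c

/-- In the involutive case, `(π ⋊ U)(f^*)` is the adjoint of `(π ⋊ U)(f)`. -/
theorem inner_integrated_invol {X : Type*} [NormedAddCommGroup X] [InnerProductSpace 𝕜 X]
    [CompleteSpace X] (ρ : ContCovRep α X)
    (hπ : ∀ (a : A) (x y : X), inner 𝕜 (ρ.π a x) y = inner 𝕜 x (ρ.π (star a) y))
    (hU : ∀ (r : G) (x y : X), inner 𝕜 (ρ.U r x) (ρ.U r y) = inner 𝕜 x y)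
    (f : C_c(G, A)) (x y : X) :
    inner 𝕜 y (ρ.integrated μ (BanachCP.invol α f) x) = inner 𝕜 (ρ.integrated μ f y) x := by
  set g : G → 𝕜 := fun s => inner 𝕜 (ρ.integrand f y s) x with hg
  have hgc : Continuous g := (ρ.continuous_integrand f y).inner continuous_const
  have hgs : HasCompactSupport g := (ρ.compact_integrand f y).mono fun s hs h0 => hs (by
    simp only [Function.mem_support, hg] at *
    rw [h0, inner_zero_left])
  have e1 : ∀ s, inner 𝕜 y (ρ.integrand (BanachCP.invol α f) x s) = modularFn s⁻¹ • g s⁻¹ := by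
    intro s
    have h1 : ρ.integrand (BanachCP.invol α f) x s =
        ((modularFn s⁻¹ : ℝ) : 𝕜) • ρ.U s (ρ.π (star (f s⁻¹)) x) := by
      rw [ContCovRep.integrand, invol_apply, map_smul, smul_apply,
        ρ.cov_apply]
    have h2 : y = ρ.U s (ρ.U s⁻¹ y) := by
      rw [← ρ.U_mul_apply]; simp
    rw [h1, inner_smul_right, RCLike.real_smul_eq_coe_mul]
    congr 1
    conv_lhs => rw [h2]
    rw [hU, ← hπ]
    rfl
  have e2 : inner 𝕜 y (ρ.integrated μ (BanachCP.invol α f) x) =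
      ∫ s, inner 𝕜 y (ρ.integrand (BanachCP.invol α f) x s) ∂μ := by
    rw [← gint_eq_integral]
    exact (gint_comm (innerSL 𝕜 y) (ρ.integrable_integrand μ _ x)).symm
  have e3 : inner 𝕜 x (ρ.integrated μ f y) = ∫ s, inner 𝕜 x (ρ.integrand f y s) ∂μ := by
    rw [← gint_eq_integral]
    exact (gint_comm (innerSL 𝕜 x) (ρ.integrable_integrand μ _ y)).symm
  rw [e2, integral_congr_ae (Eventually.of_forall e1), integral_modularFn_inv μ hgc hgs,
    ← inner_conj_symm, e3, ← integral_conj]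
  simp [hg]

theorem norm_integrated_invol_le {X : Type*} [NormedAddCommGroup X] [NormedSpace 𝕜 X]
    [CompleteSpace X] (ρ : ContCovRep α X) (hρ : ρ.Involutive)
    (f : C_c(G, A)) : ‖ρ.integrated μ (BanachCP.invol α f)‖ ≤ ‖ρ.integrated μ f‖ := by
  obtain ⟨H, rfl, hπ, hU⟩ := hρ
  refine ContinuousLinearMap.opNorm_le_bound _ (norm_nonneg _) fun x => ?_
  set z := ρ.integrated μ (BanachCP.invol α f) x
  have h := inner_integrated_invol μ ρ hπ hU f x z
  have h2 : ‖z‖ * ‖z‖ ≤ ‖ρ.integrated μ f‖ * ‖x‖ * ‖z‖ := by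
    calc ‖z‖ * ‖z‖ = ‖(inner 𝕜 z z : 𝕜)‖ := by
          rw [← sq, inner_self_eq_norm_sq_to_K]; simp
      _ = ‖(inner 𝕜 (ρ.integrated μ f z) x : 𝕜)‖ := by rw [h]
      _ ≤ ‖ρ.integrated μ f z‖ * ‖x‖ := norm_inner_le_norm _ _
      _ ≤ (‖ρ.integrated μ f‖ * ‖z‖) * ‖x‖ := by gcongr; exact ContinuousLinearMap.le_opNorm _ _
      _ = ‖ρ.integrated μ f‖ * ‖x‖ * ‖z‖ := by ring
  rcases (norm_nonneg z).eq_or_lt with h0 | h0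
  · rw [← h0]; positivity
  · exact le_of_mul_le_mul_right h2 h0

/-- If all members of `R` are involutive, then `q^R(f)^* = q^R(f^*)`. -/
theorem CrossedProduct.invol_q
    (hR : ∀ (X : BanachSp.{w} 𝕜), ∀ ρ ∈ R.mem X, ρ.Involutive) (f : C_c(G, A)) :
    CrossedProduct.invol μ R (CrossedProduct.q μ R f) =
      CrossedProduct.q μ R (BanachCP.invol α f) := by
  refine LinearMap.extendOfNorm_eq (CrossedProduct.denseRange_q μ R) ⟨1, fun g => ?_⟩ f
  change ‖CrossedProduct.q μ R (BanachCP.invol α g)‖ ≤ 1 * ‖CrossedProduct.q μ R g‖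
  rw [one_mul, norm_q, norm_q]
  exact sigma_le μ R (sigma_nonneg μ R g) fun X ρ hρ =>
    (norm_integrated_invol_le μ ρ (hR X ρ hρ) g).trans (norm_integrated_le_sigma μ R hρ g)

end Star

/-- The class `R'` on a given space: all non-degenerate continuous covariant representations
`(π, U)` with `π` contractive and `‖U_r‖ ≤ ν(r)` for all `r`. -/
def boundedReps (α : DynSys 𝕜 G A) (ν : G → ℝ≥0) (X : Type*) [NormedAddCommGroup X]
    [NormedSpace 𝕜 X] : Set (ContCovRep α X) :=
  {ρ | RepNonDegenerate ρ.π ∧ RepContractive ρ.π ∧ ∀ r : G, ‖ρ.U r‖ ≤ ν r}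

end CrossedProduct

end

end BanachCP

open BanachCP

/-
Elementary tensors `φ ⊗ u`, with `φ` a normalised bump at the identity and `u` an approximate left
identity of `A`, give the crossed product approximate left identities of norm close to `1`. This
lets a non-degenerate contractive representation `T` of the crossed product act through left
centralizers as well: an approximate left identity `u` with `‖u‖ ≤ 1 + ε` and
`T (L (u b)) = T (L u) T b` bound `T b x ↦ T (L b) x` by `‖L‖`. The system acts on the crossed
product by left centralizers, because `R` separates the points of the crossed product and every
member of `R` turns `f ↦ a f` into `π(a)` and `f ↦ α_r(f(r⁻¹ ·))` into `U_r`. Transported along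
`T`, this action is a covariant representation, and its integrated form is `T`, since the
integrated form of the action on the crossed product is left multiplication by `q^R(f)`.

In the other direction, `U_r π(a)` is the strong limit of `π ⋊ U (α_r((φ ⊗ a)(r⁻¹ ·)))` as `φ`
shrinks to the identity, so invariant subspaces, intertwining operators and adjoints pass from the
integrated form to `(π, U)`.
-/

namespace BanachCP

noncomputable section

section Nets

variable {𝕜 : Type*} [NontriviallyNormedField 𝕜] {X Y : Type*} [NormedAddCommGroup X]
  [NormedSpace 𝕜 X] [NormedAddCommGroup Y] [NormedSpace 𝕜 Y] {ι : Type*} {l : Filter ι}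
  {S : ι → X →L[𝕜] Y} {M : ℝ}

theorem tendsto_prod_nhds_of_norm_le (hM : ∀ᶠ i in l, ‖S i‖ ≤ M) {x : X} {y : Y}
    (hS : Tendsto (fun i => S i x) l (𝓝 y)) :
    Tendsto (fun p : ι × X => S p.1 p.2) (l ×ˢ 𝓝 x) (𝓝 y) := by
  have h_small : Tendsto (fun p : ι × X => S p.1 (p.2 - x)) (l ×ˢ 𝓝 x) (𝓝 0) := by
    have h_bound : Tendsto (fun p : ι × X => M * ‖p.2 - x‖) (l ×ˢ 𝓝 x) (𝓝 0) :=
      ((continuous_const.mul (continuous_id.sub continuous_const).norm).tendsto' x 0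
        (by simp)).comp tendsto_snd
    refine squeeze_zero_norm' ?_ h_bound
    filter_upwards [tendsto_fst.eventually hM] with p hp
    exact (S p.1).le_of_opNorm_le hp _
  simpa using h_small.add (hS.comp tendsto_fst)

theorem tendsto_of_dense_span {S₀ : X →L[𝕜] Y} (hM : ∀ᶠ i in l, ‖S i‖ ≤ M) {D : Set X}
    (hD : Dense (Submodule.span 𝕜 D : Set X))
    (h : ∀ x ∈ D, Tendsto (fun i => S i x) l (𝓝 (S₀ x))) (x : X) :
    Tendsto (fun i => S i x) l (𝓝 (S₀ x)) := by
  have h_span : ∀ y ∈ Submodule.span 𝕜 D, Tendsto (fun i => (S i - S₀) y) l (𝓝 0) := by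
    intro y hy
    induction hy using Submodule.span_induction with
    | mem y hy => simpa using (h y hy).sub_const (S₀ y)
    | zero => simpa only [map_zero] using tendsto_const_nhds
    | add y z _ _ hy hz => simpa only [map_add, add_zero] using hy.add hz
    | smul c y _ hy => simpa only [map_smul, smul_zero] using hy.const_smul c
  have h_bound : ∀ᶠ i in l, ‖S i - S₀‖ ≤ M + ‖S₀‖ :=
    hM.mono fun i hi => (norm_sub_le _ _).trans (by gcongr)
  rw [tendsto_iff_norm_sub_tendsto_zero, Metric.tendsto_nhds]
  intro δ hδ
  have h_near : ∀ᶠ y in 𝓝 x, (M + ‖S₀‖) * ‖x - y‖ < δ / 2 :=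
    (Continuous.tendsto' (by fun_prop) x 0 (by simp)).eventually_lt_const (half_pos hδ)
  obtain ⟨y, hyD, hy⟩ := hD.inter_nhds_nonempty h_near
  filter_upwards [h_bound, Metric.tendsto_nhds.1 (h_span y hyD) _ (half_pos hδ)] with i hi hiy
  rw [dist_zero_right] at hiy
  rw [dist_zero_right, norm_norm]
  calc ‖S i x - S₀ x‖ = ‖(S i - S₀) y + (S i - S₀) (x - y)‖ := by
        rw [← map_add, add_sub_cancel, sub_apply]
    _ ≤ ‖(S i - S₀) y‖ + (M + ‖S₀‖) * ‖x - y‖ :=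
        (norm_add_le _ _).trans (by gcongr; exact (S i - S₀).le_of_opNorm_le hi _)
    _ < δ / 2 + δ / 2 := add_lt_add hiy hy
    _ = δ := add_halves δ

end Nets

section LeftCentralizers

variable {𝕜 : Type*} [RCLike 𝕜] {B : Type*} [NonUnitalNormedRing B] [NormedSpace 𝕜 B]
  {X : Type*} [NormedAddCommGroup X] [NormedSpace 𝕜 X]
  {Y : Type*} [NormedAddCommGroup Y] [NormedSpace 𝕜 Y]
  {T : B →ₙₐ[𝕜] (X →L[𝕜] X)}

theorem RepNonDegenerate.clm_ext (hT : RepNonDegenerate T) {S S' : X →L[𝕜] Y}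
    (h : ∀ b x, S (T b x) = S' (T b x)) : S = S' := by
  refine ContinuousLinearMap.ext_on hT ?_
  rintro _ ⟨b, x, rfl⟩
  exact h b x

theorem RepNonDegenerate.of_subset_closure {D : Set X} (hD : Dense (Submodule.span 𝕜 D : Set X))
    (h : D ⊆ closure {y : X | ∃ (b : B) (x : X), y = T b x}) : RepNonDegenerate T := by
  have h_span : Submodule.span 𝕜 D ≤
      (Submodule.span 𝕜 {y : X | ∃ (b : B) (x : X), y = T b x}).topologicalClosure :=
    Submodule.span_le.2 fun x hx => closure_mono Submodule.subset_span (h hx)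
  have h_dense := hD.mono h_span
  rw [Submodule.topologicalClosure_coe] at h_dense
  exact dense_closure.1 h_dense

theorem RepContractive.bounded (hT : RepContractive T) : ∃ C : ℝ, ∀ b, ‖T b‖ ≤ C * ‖b‖ :=
  ⟨1, fun b => by simpa only [one_mul] using hT b⟩

/-- A bounded representation, as a bounded linear map from the algebra to the operators. -/
def repCLM (T : B →ₙₐ[𝕜] (X →L[𝕜] X)) (hT : ∃ C : ℝ, ∀ b, ‖T b‖ ≤ C * ‖b‖) :
    B →L[𝕜] (X →L[𝕜] X) :=
  LinearMap.mkContinuousOfExistsBound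
    { toFun := T
      map_add' := map_add T
      map_smul' := map_smul T } hT

@[simp] theorem repCLM_apply (hT : ∃ C : ℝ, ∀ b, ‖T b‖ ≤ C * ‖b‖) (b : B) :
    repCLM T hT b = T b := rfl

theorem RepNonDegenerate.tendsto_approxId (hT : RepNonDegenerate T)
    (hb : ∃ C : ℝ, ∀ b, ‖T b‖ ≤ C * ‖b‖) {l : Filter B} {M : ℝ} (hM : ∀ᶠ u in l, ‖u‖ ≤ M)
    (hl : ∀ b : B, Tendsto (fun u => u * b) l (𝓝 b)) (x : X) :
    Tendsto (fun u => T u x) l (𝓝 x) := by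
  refine tendsto_of_dense_span (S := fun u => repCLM T hb u) (S₀ := .id 𝕜 X)
    (hM.mono fun u hu => (repCLM T hb).le_of_opNorm_le_of_le le_rfl hu) hT ?_ x
  rintro _ ⟨b, y, rfl⟩
  simpa [Function.comp_def] using (((repCLM T hb).flip y).continuous.tendsto b).comp (hl b)

/-- Left centralizers of an algebra, the operators that behave like multiplications from the
left. Every non-degenerate contractive representation extends to them. -/
def IsLeftCentralizer (L : B →L[𝕜] B) : Prop := ∀ b c, L (b * c) = L b * c

/-- The linear map `b ⊗ x ↦ S b x`. It makes sense of `T b x ↦ T (L b) x` before that prescription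
is known to be well-defined. -/
def evalTensor (S : B →L[𝕜] (X →L[𝕜] X)) : TensorProduct 𝕜 B X →ₗ[𝕜] X :=
  TensorProduct.lift (ContinuousLinearMap.coeLM 𝕜 ∘ₗ S.toLinearMap)

theorem evalTensor_tmul (S : B →L[𝕜] (X →L[𝕜] X)) (b : B) (x : X) :
    evalTensor S (b ⊗ₜ[𝕜] x) = S b x := rfl

theorem RepNonDegenerate.denseRange_evalTensor (hT : RepNonDegenerate T)
    (hb : ∃ C : ℝ, ∀ b, ‖T b‖ ≤ C * ‖b‖) : DenseRange (evalTensor (repCLM T hb)) := by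
  refine Dense.mono (SetLike.coe_subset_coe.2 (Submodule.span_le.2 ?_) :
    _ ⊆ (LinearMap.range (evalTensor (repCLM T hb)) : Set X)) hT
  rintro _ ⟨b, x, rfl⟩
  exact ⟨b ⊗ₜ[𝕜] x, rfl⟩

/-- The identity `T (L (u * b)) = T (L u) ∘ T b` for an approximate left identity `u` bounds the
left-hand side. -/
theorem RepContractive.norm_evalTensor_comp_le_mul (hc : RepContractive T) {M : ℝ}
    (hB : HasBddLeftApproxId B M) {L : B →L[𝕜] B} (hL : IsLeftCentralizer L)
    (t : TensorProduct 𝕜 B X) :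
    ‖evalTensor (repCLM T hc.bounded ∘L L) t‖ ≤
      ‖L‖ * M * ‖evalTensor (repCLM T hc.bounded) t‖ := by
  obtain ⟨l, _, hM, hl⟩ := hB
  have h_lim : Tendsto (fun u => T (L u) (evalTensor (repCLM T hc.bounded) t)) l
      (𝓝 (evalTensor (repCLM T hc.bounded ∘L L) t)) := by
    induction t using TensorProduct.induction_on with
    | zero => simpa only [map_zero] using tendsto_const_nhds
    | tmul b x =>
      simpa [Function.comp_def, evalTensor_tmul, hL _ _] using
        (((repCLM T hc.bounded ∘L L).flip x).continuous.tendsto b).comp (hl b)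
    | add t u ht hu => simpa only [map_add] using ht.add hu
  refine le_of_tendsto h_lim.norm (hM.mono fun u hu => ?_)
  exact (T (L u)).le_of_opNorm_le ((hc _).trans (L.le_of_opNorm_le_of_le le_rfl hu)) _

theorem RepContractive.norm_evalTensor_comp_le (hc : RepContractive T)
    (hB : ∀ ε : ℝ, 0 < ε → HasBddLeftApproxId B (1 + ε)) {L : B →L[𝕜] B}
    (hL : IsLeftCentralizer L) (t : TensorProduct 𝕜 B X) :
    ‖evalTensor (repCLM T hc.bounded ∘L L) t‖ ≤
      ‖L‖ * ‖evalTensor (repCLM T hc.bounded) t‖ := by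
  have h_lim : Tendsto (fun ε : ℝ => ‖L‖ * (1 + ε) * ‖evalTensor (repCLM T hc.bounded) t‖) (𝓝[>] 0)
      (𝓝 (‖L‖ * ‖evalTensor (repCLM T hc.bounded) t‖)) :=
    (Continuous.tendsto' (by fun_prop) 0 _ (by simp)).mono_left nhdsWithin_le_nhds
  exact ge_of_tendsto h_lim (eventually_nhdsWithin_of_forall fun ε hε =>
    hc.norm_evalTensor_comp_le_mul (hB ε hε) hL t)

variable [CompleteSpace X]

/-- The operator `T b x ↦ T (L b) x` that a left centralizer `L` induces on the space of a
representation `T`; it is junk unless this prescription is bounded. -/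
def leftExtend (T : B →ₙₐ[𝕜] (X →L[𝕜] X)) (hb : ∃ C : ℝ, ∀ b, ‖T b‖ ≤ C * ‖b‖) (L : B →L[𝕜] B) :
    X →L[𝕜] X :=
  (evalTensor (repCLM T hb ∘L L)).extendOfNorm (evalTensor (repCLM T hb))

theorem leftExtend_apply (hT : RepNonDegenerate T) (hc : RepContractive T)
    (hB : ∀ ε : ℝ, 0 < ε → HasBddLeftApproxId B (1 + ε)) {L : B →L[𝕜] B}
    (hL : IsLeftCentralizer L) (b : B) (x : X) :
    leftExtend T hc.bounded L (T b x) = T (L b) x :=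
  LinearMap.extendOfNorm_eq (hT.denseRange_evalTensor hc.bounded)
    ⟨‖L‖, hc.norm_evalTensor_comp_le hB hL⟩ (b ⊗ₜ[𝕜] x)

theorem leftExtend_eq (hT : RepNonDegenerate T) (hc : RepContractive T)
    (hB : ∀ ε : ℝ, 0 < ε → HasBddLeftApproxId B (1 + ε)) {L : B →L[𝕜] B}
    (hL : IsLeftCentralizer L) {S : X →L[𝕜] X} (h : ∀ b x, S (T b x) = T (L b) x) :
    leftExtend T hc.bounded L = S :=
  hT.clm_ext fun b x => (leftExtend_apply hT hc hB hL b x).trans (h b x).symm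

theorem norm_leftExtend_le (hT : RepNonDegenerate T) (hc : RepContractive T)
    (hB : ∀ ε : ℝ, 0 < ε → HasBddLeftApproxId B (1 + ε)) {L : B →L[𝕜] B}
    (hL : IsLeftCentralizer L) : ‖leftExtend T hc.bounded L‖ ≤ ‖L‖ :=
  LinearMap.opNorm_extendOfNorm_le (hT.denseRange_evalTensor hc.bounded) (norm_nonneg L)
    (hc.norm_evalTensor_comp_le hB hL)

end LeftCentralizers

section Bumps

theorem norm_gint_smul_sub_le {G : Type*} [TopologicalSpace G] [MeasurableSpace G]
    [BorelSpace G] {μ : Measure G} [IsFiniteMeasureOnCompacts μ] {𝕜 : Type*} [RCLike 𝕜]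
    {X : Type*} [NormedAddCommGroup X] [NormedSpace 𝕜 X] [CompleteSpace X] {φ : C_c(G, ℝ)}
    (h0 : ∀ s, 0 ≤ φ s) (h1 : ∫ s, φ s ∂μ = 1) {F : G → X} (hF : Continuous F)
    {x : X} {δ : ℝ} (hδ : ∀ s, φ s ≠ 0 → ‖F s - x‖ ≤ δ) :
    ‖gint 𝕜 μ (fun s => (φ s : 𝕜) • F s) - x‖ ≤ δ := by
  let _ : NormedSpace ℝ X := NormedSpace.restrictScalars ℝ 𝕜 X
  have hφ : Integrable φ μ := φ.continuous.integrable_of_hasCompactSupport φ.hasCompactSupport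
  have hφF : Integrable (fun s => φ s • F s) μ :=
    (φ.continuous.smul hF).integrable_of_hasCompactSupport φ.hasCompactSupport.smul_right
  have h_sub : gint 𝕜 μ (fun s => (φ s : 𝕜) • F s) - x = ∫ s, φ s • (F s - x) ∂μ := by
    have hx : ∫ s, φ s • x ∂μ = x := by rw [integral_smul_const, h1, one_smul]
    conv_lhs => rw [← hx]
    simp only [smul_sub]
    exact (integral_sub hφF (hφ.smul_const x)).symm
  have h_pt : ∀ s, ‖φ s • (F s - x)‖ ≤ φ s * δ := fun s => by
    rw [norm_smul, Real.norm_of_nonneg (h0 s)]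
    rcases eq_or_ne (φ s) 0 with hs | hs
    · simp [hs]
    · exact mul_le_mul_of_nonneg_left (hδ s hs) (h0 s)
  calc ‖gint 𝕜 μ (fun s => (φ s : 𝕜) • F s) - x‖ ≤ ∫ s, φ s * δ ∂μ := by
        rw [h_sub]
        exact norm_integral_le_of_norm_le (hφ.mul_const δ) (.of_forall h_pt)
    _ = δ := by rw [integral_mul_const, h1, one_mul]

variable {G : Type*} [Group G] [TopologicalSpace G] [MeasurableSpace G] (μ : Measure G)

/-- The filter of normalised non-negative functions in `C_c(G)` supported close to the identity,
an approximate identity encoded as a filter. -/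
def bumps : Filter C_c(G, ℝ) :=
  (𝓝 (1 : G)).lift' fun W => {φ | (∀ s, 0 ≤ φ s) ∧ ∫ s, φ s ∂μ = 1 ∧ ∀ s ∉ W, φ s = 0}

theorem eventually_bumps {W : Set G} (hW : W ∈ 𝓝 (1 : G)) :
    ∀ᶠ φ in bumps μ, (∀ s, 0 ≤ φ s) ∧ ∫ s, φ s ∂μ = 1 ∧ ∀ s ∉ W, φ s = 0 :=
  mem_lift' hW

theorem tendsto_gint_bumps_smul [BorelSpace G] [IsFiniteMeasureOnCompacts μ] {𝕜 : Type*}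
    [RCLike 𝕜] {X : Type*} [NormedAddCommGroup X] [NormedSpace 𝕜 X] [CompleteSpace X] {F : G → X}
    (hF : Continuous F) :
    Tendsto (fun φ : C_c(G, ℝ) => gint 𝕜 μ fun s => (φ s : 𝕜) • F s) (bumps μ) (𝓝 (F 1)) := by
  refine Metric.nhds_basis_closedBall.tendsto_right_iff.2 fun δ hδ => ?_
  have hW : F ⁻¹' Metric.closedBall (F 1) δ ∈ 𝓝 (1 : G) :=
    hF.continuousAt (Metric.closedBall_mem_nhds _ hδ)
  filter_upwards [eventually_bumps μ hW] with φ ⟨h0, h1, h_supp⟩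
  rw [mem_closedBall_iff_norm]
  refine norm_gint_smul_sub_le h0 h1 hF fun s hs => ?_
  rw [← mem_closedBall_iff_norm]
  exact not_imp_comm.1 (h_supp s) hs

instance neBot_bumps [IsTopologicalGroup G] [LocallyCompactSpace G] [BorelSpace G]
    [μ.IsHaarMeasure] : (bumps μ).NeBot := by
  have h_mono : Monotone fun W : Set G =>
      {φ : C_c(G, ℝ) | (∀ s, 0 ≤ φ s) ∧ ∫ s, φ s ∂μ = 1 ∧ ∀ s ∉ W, φ s = 0} :=
    fun V W hVW φ hφ => ⟨hφ.1, hφ.2.1, fun s hs => hφ.2.2 s (hs ∘ @hVW s)⟩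
  refine (lift'_neBot_iff h_mono).2 fun W hW => ?_
  obtain ⟨f, hf1, hf0, hfc, hf01⟩ := exists_continuous_one_zero_of_isCompact
    (isCompact_singleton (x := (1 : G))) (isOpen_interior (s := W)).isClosed_compl
    (by simpa using mem_interior_iff_mem_nhds.2 hW)
  have hpos : 0 < ∫ s, f s ∂μ :=
    f.continuous.integral_pos_of_hasCompactSupport_nonneg_nonzero hfc (fun s => (hf01 s).1)
      (x := 1) (by rw [hf1 rfl]; exact one_ne_zero)
  refine ⟨⟨⟨fun s => (∫ s, f s ∂μ)⁻¹ * f s, by fun_prop⟩, hfc.mul_left⟩,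
    fun s => mul_nonneg (inv_nonneg.2 hpos.le) (hf01 s).1, ?_, fun s hs => ?_⟩
  · exact (integral_const_mul _ _).trans (inv_mul_cancel₀ hpos.ne')
  · exact mul_eq_zero_of_right _ (hf0 fun h => hs (interior_subset h))

end Bumps

section CompactlySupported

variable {𝕜 G A : Type*} [RCLike 𝕜] [TopologicalSpace G] [NonUnitalNormedRing A] [NormedSpace 𝕜 A]

variable (𝕜 G) in
/-- The operator `f ↦ (s ↦ a f(s))` on `C_c(G, A)`, implementing `π(a)` in integrated forms. -/
def coeffMul [SMulCommClass 𝕜 A A] (a : A) : C_c(G, A) →ₗ[𝕜] C_c(G, A) where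
  toFun f := ⟨⟨fun s => a * f s, by have := f.continuous; fun_prop⟩, f.hasCompactSupport.mul_left⟩
  map_add' f g := by ext s; exact mul_add _ _ _
  map_smul' c f := by ext s; exact mul_smul_comm _ _ _

@[simp] theorem coeffMul_apply [SMulCommClass 𝕜 A A] (a : A) (f : C_c(G, A)) (s : G) :
    coeffMul 𝕜 G a f s = a * f s := rfl

/-- The operator `f ↦ (s ↦ α_r(f(r⁻¹ s)))` on `C_c(G, A)`, implementing `U_r` in integrated
forms. -/
def translate [Group G] [IsTopologicalGroup G] (α : DynSys 𝕜 G A) (r : G) :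
    C_c(G, A) →ₗ[𝕜] C_c(G, A) where
  toFun f := ⟨⟨fun s => α.act r (f (r⁻¹ * s)), by have := f.continuous; fun_prop⟩,
    (f.hasCompactSupport.comp_homeomorph (Homeomorph.mulLeft r⁻¹)).comp_left
      (g := α.act r) (map_zero _)⟩
  map_add' f g := by ext s; exact map_add (α.act r) _ _
  map_smul' c f := by ext s; exact map_smul (α.act r) _ _

@[simp] theorem translate_apply [Group G] [IsTopologicalGroup G] (α : DynSys 𝕜 G A) (r : G)
    (f : C_c(G, A)) (s : G) : translate α r f s = α.act r (f (r⁻¹ * s)) := rfl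

variable (𝕜) in
/-- The elementary tensor `φ ⊗ a`, that is, the function `s ↦ φ(s) a`. -/
def tens (φ : C_c(G, ℝ)) (a : A) : C_c(G, A) where
  toFun s := (φ s : 𝕜) • a
  continuous_toFun := by have := φ.continuous; fun_prop
  hasCompactSupport' := φ.hasCompactSupport.mono fun s hs h => hs (by simp [h])

@[simp] theorem tens_apply (φ : C_c(G, ℝ)) (a : A) (s : G) : tens 𝕜 φ a s = (φ s : 𝕜) • a := rfl

end CompactlySupported

namespace ContCovRep

variable {𝕜 G A : Type*} [RCLike 𝕜] [Group G] [TopologicalSpace G] [MeasurableSpace G]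
  [BorelSpace G] [NonUnitalNormedRing A] [NormedSpace 𝕜 A] {α : DynSys 𝕜 G A}
  {X : Type*} [NormedAddCommGroup X] [NormedSpace 𝕜 X] [CompleteSpace X]
  {Y : Type*} [NormedAddCommGroup Y] [NormedSpace 𝕜 Y] [CompleteSpace Y]
  (μ : Measure G)

section Integrated

variable [IsFiniteMeasureOnCompacts μ] (ρ : ContCovRep α X)

theorem integrated_coeffMul [SMulCommClass 𝕜 A A] (a : A) (f : C_c(G, A)) :
    ρ.integrated μ (coeffMul 𝕜 G a f) = ρ.π a * ρ.integrated μ f := by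
  ext x
  exact (congrArg (gint 𝕜 μ) (funext fun s => DFunLike.congr_fun (map_mul ρ.π a (f s)) _)).trans
    (gint_comm (ρ.π a) (ρ.integrable_integrand μ f x))

theorem integrated_tens (φ : C_c(G, ℝ)) (a : A) (x : X) :
    ρ.integrated μ (tens 𝕜 φ a) x = gint 𝕜 μ fun s => (φ s : 𝕜) • ρ.π a (ρ.U s x) := by
  simp only [integrated_apply, tens_apply, map_smul, smul_apply]

theorem integrated_translate [IsTopologicalGroup G] [μ.IsMulLeftInvariant] (r : G)
    (f : C_c(G, A)) : ρ.integrated μ (translate α r f) = ρ.U r * ρ.integrated μ f := by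
  ext x
  rw [mul_apply_eq_comp, integrated_apply, integrated_apply,
    ← gint_mul_left (μ := μ) r (fun s => ρ.π (translate α r f s) (ρ.U s x))]
  simp only [translate_apply, inv_mul_cancel_left, U_mul_apply, cov_apply]
  exact gint_comm (ρ.U r) (ρ.integrable_integrand μ f x)

theorem tendsto_integrated_translate_tens [IsTopologicalGroup G] [μ.IsMulLeftInvariant] (r : G)
    (a : A) (x : X) :
    Tendsto (fun φ => ρ.integrated μ (translate α r (tens 𝕜 φ a)) x) (bumps μ)
      (𝓝 (ρ.U r (ρ.π a x))) := by
  simp only [integrated_translate, mul_apply_eq_comp, integrated_tens]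
  have h := tendsto_gint_bumps_smul (𝕜 := 𝕜) μ ((ρ.π a).continuous.comp (ρ.strongCont x))
  rw [Function.comp_apply, map_one, one_apply_eq_self] at h
  exact ((ρ.U r).continuous.tendsto _).comp h

theorem tendsto_integrated_tens_approxId (hπ : RepNonDegenerate ρ.π) {l : Filter A} {M : ℝ}
    (hM : ∀ᶠ u in l, ‖u‖ ≤ M) (hl : ∀ a : A, Tendsto (fun u => u * a) l (𝓝 a)) (x : X) :
    Tendsto (fun p : C_c(G, ℝ) × A => ρ.integrated μ (tens 𝕜 p.1 p.2) x) (bumps μ ×ˢ l) (𝓝 x) := by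
  have h_bump : Tendsto (fun φ : C_c(G, ℝ) => gint 𝕜 μ fun s => (φ s : 𝕜) • ρ.U s x) (bumps μ)
      (𝓝 x) := by
    simpa using tendsto_gint_bumps_smul (𝕜 := 𝕜) μ (ρ.strongCont x)
  have h_joint := tendsto_prod_nhds_of_norm_le (S := fun u => ρ.πL u)
    (hM.mono fun u hu => ρ.πL.le_of_opNorm_le_of_le le_rfl hu)
    (hπ.tendsto_approxId ρ.bounded hM hl x)
  refine (h_joint.comp (tendsto_snd.prodMk (h_bump.comp tendsto_fst))).congr fun p => ?_
  have h_int : Integrable (fun s => (p.1 s : 𝕜) • ρ.U s x) μ :=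
    ((RCLike.continuous_ofReal.comp p.1.continuous).smul
      (ρ.strongCont x)).integrable_of_hasCompactSupport
        (p.1.hasCompactSupport.comp_left RCLike.ofReal_zero).smul_right
  simpa only [Function.comp_apply, πL_apply, integrated_tens, map_smul] using
    (gint_comm (ρ.π p.2) h_int).symm

end Integrated

section Equivalences

variable {ρ : ContCovRep α X} {τ : ContCovRep α Y}

omit [MeasurableSpace G] [BorelSpace G] [CompleteSpace X] in
theorem eq_of_intertwines_id {τ : ContCovRep α X} (h : ρ.Intertwines τ (.id 𝕜 X)) : ρ = τ := by
  obtain ⟨hπ, hU⟩ := h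
  cases ρ
  cases τ
  congr 1
  · ext a x
    exact (DFunLike.congr_fun (hπ a) x).symm
  · ext r x
    exact (DFunLike.congr_fun (hU r) x).symm

variable {μ}

theorem Invariant.integrated_apply_mem [IsFiniteMeasureOnCompacts μ] {Z : Submodule 𝕜 X}
    (hZ : IsClosed (Z : Set X)) (h : ρ.Invariant Z) (f : C_c(G, A)) {x : X} (hx : x ∈ Z) :
    ρ.integrated μ f x ∈ Z := by
  rw [← Submodule.Quotient.mk_eq_zero]
  refine (gint_comm Z.mkQL (ρ.integrable_integrand μ f x)).symm.trans ?_
  have h_mk : ∀ s, Z.mkQL (ρ.integrand f x s) = 0 := fun s =>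
    (Submodule.Quotient.mk_eq_zero Z).2 (h.1 _ _ (h.2 s x hx))
  simp only [h_mk, gint, integral_zero]

theorem Intertwines.integrated [IsFiniteMeasureOnCompacts μ] {Φ : X →L[𝕜] Y}
    (h : ρ.Intertwines τ Φ) (f : C_c(G, A)) :
    τ.integrated μ f ∘L Φ = Φ ∘L ρ.integrated μ f := by
  have h_int : ∀ x s, τ.integrand f (Φ x) s = Φ (ρ.integrand f x s) := fun x s =>
    (congrArg (τ.π (f s)) (DFunLike.congr_fun (h.2 s) x)).trans
      (DFunLike.congr_fun (h.1 (f s)) (ρ.U s x))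
  ext x
  exact (congrArg (gint 𝕜 μ) (funext (h_int x))).trans
    (gint_comm Φ (ρ.integrable_integrand μ f x))

variable [IsTopologicalGroup G] [LocallyCompactSpace G] [μ.IsHaarMeasure]

variable (μ) in
theorem invariant_iff_integrated (hπ : RepNonDegenerate ρ.π) {M : ℝ}
    (hA : HasBddLeftApproxId A M) {Z : Submodule 𝕜 X} (hZ : IsClosed (Z : Set X)) :
    ρ.Invariant Z ↔ ∀ f : C_c(G, A), ∀ x ∈ Z, ρ.integrated μ f x ∈ Z := by
  refine ⟨fun h f x => h.integrated_apply_mem hZ f, fun h => ?_⟩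
  have h_mem : ∀ (r : G) (a : A), ∀ x ∈ Z, ρ.U r (ρ.π a x) ∈ Z := fun r a x hx =>
    hZ.mem_of_tendsto (ρ.tendsto_integrated_translate_tens μ r a x) (.of_forall fun φ => h _ x hx)
  refine ⟨fun a x hx => by simpa using h_mem 1 a x hx, fun r x hx => ?_⟩
  obtain ⟨l, _, hM, hl⟩ := hA
  exact hZ.mem_of_tendsto
    (((ρ.U r).continuous.tendsto x).comp (hπ.tendsto_approxId ρ.bounded hM hl x))
    (.of_forall fun u => h_mem r u x hx)

variable (μ) in
theorem intertwines_iff_integrated (hπ : RepNonDegenerate ρ.π) {Φ : X →L[𝕜] Y} :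
    ρ.Intertwines τ Φ ↔ ∀ f : C_c(G, A), τ.integrated μ f ∘L Φ = Φ ∘L ρ.integrated μ f := by
  refine ⟨fun h => h.integrated, fun h => ?_⟩
  have h_lim : ∀ (r : G) (a : A) (x : X), τ.U r (τ.π a (Φ x)) = Φ (ρ.U r (ρ.π a x)) :=
    fun r a x => tendsto_nhds_unique_of_eventuallyEq
      (τ.tendsto_integrated_translate_tens μ r a (Φ x))
      ((Φ.continuous.tendsto _).comp (ρ.tendsto_integrated_translate_tens μ r a x))
      (.of_forall fun φ => DFunLike.congr_fun (h _) x)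
  have h_alg : ∀ (a : A) (x : X), τ.π a (Φ x) = Φ (ρ.π a x) := by simpa using h_lim 1
  refine ⟨fun a => ContinuousLinearMap.ext (h_alg a), fun r => hπ.clm_ext fun a x => ?_⟩
  rw [ContinuousLinearMap.comp_apply, ContinuousLinearMap.comp_apply, ← h_alg, h_lim]

end Equivalences

section Involutive

variable [IsTopologicalGroup G] [LocallyCompactSpace G] [T2Space G] [μ.IsHaarMeasure]
  [CompleteSpace A] [StarRing A] [StarModule 𝕜 A] [ContinuousStar A]

theorem integrated_invol_apply (ρ : ContCovRep α X) (f : C_c(G, A)) (x : X) :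
    ρ.integrated μ (invol α f) x = gint 𝕜 μ fun s => ρ.U s⁻¹ (ρ.π (star (f s)) x) := by
  let _ : NormedSpace ℝ X := NormedSpace.restrictScalars ℝ 𝕜 X
  have h_cont : Continuous fun s => ρ.U s⁻¹ (ρ.π (star (f s)) x) :=
    (joint_continuous ρ.strongCont).comp (continuous_inv.prodMk
      ((ρ.πL.continuous.comp (continuous_star.comp f.continuous)).clm_apply continuous_const))
  have h_supp : HasCompactSupport fun s => ρ.U s⁻¹ (ρ.π (star (f s)) x) :=
    f.hasCompactSupport.mono fun s hs h0 => hs (by simp [h0])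
  refine Eq.trans (congrArg (gint 𝕜 μ) (funext fun s => ?_))
    (integral_modularFn_inv μ h_cont h_supp)
  rw [invol_apply, map_smul, smul_apply, cov_apply, inv_inv]
  rfl

theorem tendsto_integrated_invol_translate_tens (ρ : ContCovRep α X) (r : G) (a : A) (x : X) :
    Tendsto (fun φ => ρ.integrated μ (invol α (translate α r (tens 𝕜 φ a))) x) (bumps μ)
      (𝓝 (ρ.U r⁻¹ (ρ.π (star (α.act r a)) x))) := by
  have h_int : ∀ φ : C_c(G, ℝ), ρ.integrated μ (invol α (translate α r (tens 𝕜 φ a))) x =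
      gint 𝕜 μ fun s => (φ s : 𝕜) • ρ.U (r * s)⁻¹ (ρ.π (star (α.act r a)) x) := fun φ => by
    rw [integrated_invol_apply, ← gint_mul_left (μ := μ) r]
    simp only [translate_apply, tens_apply, inv_mul_cancel_left, map_smul, star_smul,
      RCLike.star_def, RCLike.conj_ofReal, smul_apply]
  have h_cont : Continuous fun s => ρ.U (r * s)⁻¹ (ρ.π (star (α.act r a)) x) :=
    (ρ.strongCont _).comp (by fun_prop)
  simpa only [h_int, mul_one] using tendsto_gint_bumps_smul (𝕜 := 𝕜) μ h_cont

theorem inner_U_π_of_integrated {X : Type*} [NormedAddCommGroup X] [InnerProductSpace 𝕜 X]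
    [CompleteSpace X] {ρ : ContCovRep α X}
    (h : ∀ (f : C_c(G, A)) (x y : X), inner 𝕜 (ρ.integrated μ f x) y =
      inner 𝕜 x (ρ.integrated μ (invol α f) y)) (r : G) (a : A) (x y : X) :
    inner 𝕜 (ρ.U r (ρ.π a x)) y = inner 𝕜 x (ρ.U r⁻¹ (ρ.π (star (α.act r a)) y)) :=
  tendsto_nhds_unique_of_eventuallyEq
    ((ρ.tendsto_integrated_translate_tens μ r a x).inner tendsto_const_nhds)
    (tendsto_const_nhds.inner (ρ.tendsto_integrated_invol_translate_tens μ r a y))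
    (.of_forall fun _ => h _ x y)

theorem involutive_iff_integrated [IsScalarTower 𝕜 A A] [SMulCommClass 𝕜 A A]
    {ρ : ContCovRep α X} (hπ : RepNonDegenerate ρ.π) :
    ρ.Involutive ↔ ∃ H : InnerProductSpace 𝕜 X, H.toNormedSpace = ‹NormedSpace 𝕜 X› ∧
      ∀ (f : C_c(G, A)) (x y : X), H.inner (ρ.integrated μ f x) y =
        H.inner x (ρ.integrated μ (invol α f) y) := by
  refine ⟨fun ⟨H, hH, hπ, hU⟩ => ⟨H, hH, ?_⟩, fun ⟨H, hH, h⟩ => ⟨H, hH, ?_⟩⟩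
  · subst hH
    exact fun f x y => (inner_integrated_invol μ ρ hπ hU f y x).symm
  subst hH
  have h_lim := inner_U_π_of_integrated μ h
  have h_alg : ∀ (a : A) (x y : X), inner 𝕜 (ρ.π a x) y = inner 𝕜 x (ρ.π (star a) y) := by
    simpa using h_lim 1
  refine ⟨h_alg, fun r x y => ?_⟩
  -- For `a = α_{r⁻¹}(b*)` the operator on the right-hand side of `h_lim` is `U_{r⁻¹} π(b)`.
  have h_adj : innerSL 𝕜 (ρ.U r x) = innerSL 𝕜 x ∘L ρ.U r⁻¹ := hπ.clm_ext fun b z => by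
    have hb : star (α.act r (α.act r⁻¹ (star b))) = b := by
      rw [← mul_apply_eq_comp, ← map_mul, mul_inv_cancel, map_one, one_apply_eq_self, star_star]
    have h_cov := h_lim r (α.act r⁻¹ (star b)) x z
    rw [← cov_apply, h_alg, hb] at h_cov
    simpa using h_cov
  simpa [U_inv_apply] using DFunLike.congr_fun h_adj (ρ.U r y)

end Involutive

end ContCovRep

section Convergence

variable {𝕜 G A : Type*} [RCLike 𝕜] [Group G] [TopologicalSpace G] [IsTopologicalGroup G]
  [T2Space G] [LocallyCompactSpace G] [MeasurableSpace G] [BorelSpace G]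
  [NonUnitalNormedRing A] [NormedSpace 𝕜 A] [CompleteSpace A]
  [IsScalarTower 𝕜 A A] [SMulCommClass 𝕜 A A]
  (μ : Measure G) [μ.IsHaarMeasure] {α : DynSys 𝕜 G A} (R : UnifBddClass.{w} α)

theorem norm_q_le_mul_integral_norm {C M : ℝ} (hC : 0 ≤ C) (hM : 0 ≤ M) {f : C_c(G, A)}
    (hR : ∀ X : BanachSp.{w} 𝕜, ∀ ρ ∈ R.mem X,
      (∀ a, ‖ρ.π a‖ ≤ C * ‖a‖) ∧ ∀ s ∈ tsupport f, ‖ρ.U s‖ ≤ M) :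
    ‖CrossedProduct.q μ R f‖ ≤ C * M * ∫ s, ‖f s‖ ∂μ := by
  have hb : 0 ≤ C * M * ∫ s, ‖f s‖ ∂μ :=
    mul_nonneg (mul_nonneg hC hM) (integral_nonneg fun _ => norm_nonneg _)
  rw [CrossedProduct.norm_q]
  refine sigma_le μ R hb fun X ρ hρ => ContinuousLinearMap.opNorm_le_bound _ hb fun x => ?_
  exact ρ.norm_gint_integrand_le μ f x (hR X ρ hρ).1 hC (hR X ρ hρ).2

theorem exists_norm_q_le_mul_integral_norm {K : Set G} (hK : IsCompact K) :
    ∃ C : ℝ, 0 ≤ C ∧ ∀ f : C_c(G, A), tsupport f ⊆ K →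
      ‖CrossedProduct.q μ R f‖ ≤ C * ∫ s, ‖f s‖ ∂μ := by
  obtain ⟨C, ν, hν, hR⟩ := R.bdd
  obtain ⟨M, hM⟩ := hν K hK
  refine ⟨C * M, by positivity, fun f hf =>
    norm_q_le_mul_integral_norm μ R C.2 M.2 fun X ρ hρ => ⟨(hR X ρ hρ).1, fun s hs => ?_⟩⟩
  exact ((hR X ρ hρ).2 s).trans (NNReal.coe_le_coe.2 (hM (mem_image_of_mem ν (hf hs))))

theorem exists_norm_q_le_mul_of_norm_le {K : Set G} (hK : IsCompact K) :
    ∃ C : ℝ, ∀ (f : C_c(G, A)) (δ : ℝ), (∀ s ∉ K, f s = 0) → (∀ s ∈ K, ‖f s‖ ≤ δ) →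
      ‖CrossedProduct.q μ R f‖ ≤ C * δ := by
  obtain ⟨C, hC, h⟩ := exists_norm_q_le_mul_integral_norm μ R hK
  refine ⟨C * μ.real K, fun f δ h0 hδ => ?_⟩
  have hf : tsupport f ⊆ K :=
    closure_minimal (fun s hs => not_imp_comm.1 (h0 s) hs) hK.isClosed
  have h_int : ∫ s, ‖f s‖ ∂μ ≤ δ * μ.real K := by
    rw [← setIntegral_eq_integral_of_forall_compl_eq_zero (s := K)
      fun s hs => by rw [h0 s hs, norm_zero]]
    exact (le_abs_self _).trans (norm_setIntegral_le_of_norm_le_const (f := fun s => ‖f s‖)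
      hK.measure_lt_top fun s hs => (norm_norm (f s)).trans_le (hδ s hs))
  calc ‖CrossedProduct.q μ R f‖ ≤ C * (δ * μ.real K) :=
        (h f hf).trans (mul_le_mul_of_nonneg_left h_int hC)
    _ = C * μ.real K * δ := by ring

theorem tendsto_q {ι : Type*} {l : Filter ι} {F : ι → C_c(G, A)} {f : C_c(G, A)} {K : Set G}
    (hK : IsCompact K) (hF : ∀ᶠ i in l, ∀ s ∉ K, F i s = 0) (hf : ∀ s ∉ K, f s = 0)
    (h : ∀ s, Tendsto (fun p : ι × G => F p.1 p.2) (l ×ˢ 𝓝 s) (𝓝 (f s))) :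
    Tendsto (fun i => CrossedProduct.q μ R (F i)) l (𝓝 (CrossedProduct.q μ R f)) := by
  have h_unif : TendstoUniformlyOn (fun i => ⇑(F i)) f l K := by
    rw [← tendstoLocallyUniformlyOn_iff_tendstoUniformlyOn_of_compact hK,
      tendstoLocallyUniformlyOn_iff_forall_tendsto]
    intro s _
    have h_snd : Tendsto (fun p : ι × G => f p.2) (l ×ˢ 𝓝[K] s) (𝓝 (f s)) :=
      (f.continuous.tendsto s).comp (tendsto_snd.mono_right nhdsWithin_le_nhds)
    have h_fst : Tendsto (fun p : ι × G => F p.1 p.2) (l ×ˢ 𝓝[K] s) (𝓝 (f s)) :=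
      (h s).mono_left (prod_mono_right l nhdsWithin_le_nhds)
    exact (h_snd.prodMk_nhds h_fst).mono_right (nhds_le_uniformity (f s))
  obtain ⟨C, hC⟩ := exists_norm_q_le_mul_of_norm_le μ R hK
  rw [tendsto_iff_norm_sub_tendsto_zero, Metric.tendsto_nhds]
  intro ε hε
  obtain ⟨δ, hδ, hCδ⟩ : ∃ δ, 0 < δ ∧ C * δ < ε := by
    have h_lim : Tendsto (fun δ => C * δ) (𝓝[>] 0) (𝓝 0) :=
      (Continuous.tendsto' (by fun_prop) 0 0 (mul_zero C)).mono_left nhdsWithin_le_nhds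
    exact (eventually_mem_nhdsWithin.and (h_lim.eventually_lt_const hε)).exists
  filter_upwards [hF, Metric.tendstoUniformlyOn_iff.1 h_unif δ hδ] with i h0 hi
  rw [dist_zero_right, norm_norm, ← map_sub]
  refine (hC (F i - f) δ (fun s hs => ?_) fun s hs => ?_).trans_lt hCδ
  · exact sub_eq_zero.2 ((h0 s hs).trans (hf s hs).symm)
  · exact (dist_eq_norm' (f s) (F i s)).symm.trans_le (hi s hs).le

open Pointwise in
theorem continuous_q_translate (f : C_c(G, A)) :
    Continuous fun r => CrossedProduct.q μ R (translate α r f) := by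
  refine continuous_iff_continuousAt.2 fun r₀ => ?_
  obtain ⟨K, hK, hr₀⟩ := exists_compact_mem_nhds r₀
  have h_supp : ∀ r ∈ K, ∀ s ∉ K * tsupport f, translate α r f s = 0 := by
    intro r hr s hs
    have h0 : f (r⁻¹ * s) = 0 := image_eq_zero_of_notMem_tsupport fun h =>
      hs ⟨r, hr, r⁻¹ * s, h, mul_inv_cancel_left r s⟩
    rw [translate_apply, h0, map_zero]
  have h_cont : Continuous fun p : G × G => translate α p.1 f p.2 := by
    exact (joint_continuous α.act_cont).comp
      (continuous_fst.prodMk (f.continuous.comp (continuous_fst.inv.mul continuous_snd)))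
  refine tendsto_q μ R (hK.mul f.hasCompactSupport) (mem_of_superset hr₀ h_supp)
    (h_supp r₀ (mem_of_mem_nhds hr₀)) fun s => ?_
  rw [← nhds_prod_eq]
  exact h_cont.tendsto (r₀, s)

theorem tendsto_q_coeffMul {l : Filter A} {M : ℝ} (hM : ∀ᶠ u in l, ‖u‖ ≤ M)
    (hl : ∀ a : A, Tendsto (fun u => u * a) l (𝓝 a)) (f : C_c(G, A)) :
    Tendsto (fun u => CrossedProduct.q μ R (coeffMul 𝕜 G u f)) l
      (𝓝 (CrossedProduct.q μ R f)) := by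
  have h_supp : ∀ s ∉ tsupport f, f s = 0 := fun s hs => image_eq_zero_of_notMem_tsupport hs
  refine tendsto_q μ R f.hasCompactSupport (.of_forall fun u s hs => ?_) h_supp fun s => ?_
  · rw [coeffMul_apply, h_supp s hs, mul_zero]
  · have h_mul : ∀ᶠ u in l, ‖ContinuousLinearMap.mul 𝕜 A u‖ ≤ M :=
      hM.mono fun u hu => (ContinuousLinearMap.opNorm_mul_apply_le 𝕜 A u).trans hu
    exact (tendsto_prod_nhds_of_norm_le h_mul (hl (f s))).comp
      (tendsto_id.prodMap (f.continuous.tendsto s))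

end Convergence

section LeftRegular

variable {𝕜 G A : Type*} [RCLike 𝕜] [Group G] [TopologicalSpace G] [IsTopologicalGroup G]
  [T2Space G] [LocallyCompactSpace G] [MeasurableSpace G] [BorelSpace G]
  [NonUnitalNormedRing A] [NormedSpace 𝕜 A] [CompleteSpace A]
  [IsScalarTower 𝕜 A A] [SMulCommClass 𝕜 A A]
  (μ : Measure G) [μ.IsHaarMeasure] {α : DynSys 𝕜 G A} {R : UnifBddClass.{w} α}
  {X : BanachSp.{w} 𝕜}

open CrossedProduct

variable {μ} in
theorem CrossedProduct.clm_ext {E : Type*} [NormedAddCommGroup E] [NormedSpace 𝕜 E]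
    {S S' : CrossedProduct μ R →L[𝕜] E} (h : ∀ f, S (q μ R f) = S' (q μ R f)) : S = S' :=
  DFunLike.coe_injective ((denseRange_q μ R).equalizer S.continuous S'.continuous (funext h))

theorem repContractive_integratedRep (ρ : R.mem X) : RepContractive (integratedRep μ ρ) :=
  fun c => (LinearMap.norm_extendOfNorm_apply_le (denseRange_q μ R) 1
    (norm_integratedLin_le μ ρ.2) c).trans_eq (one_mul _)

/-- The map `c ↦ (π ⋊ U)^R(c) x`. -/
def orbitMap (ρ : R.mem X) (x : X) : CrossedProduct μ R →L[𝕜] X :=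
  (repCLM (integratedRep μ ρ) (repContractive_integratedRep μ ρ).bounded).flip x

theorem orbitMap_apply (ρ : R.mem X) (x : X) (c : CrossedProduct μ R) :
    orbitMap μ ρ x c = integratedRep μ ρ c x := rfl

theorem ext_orbitMap {c d : CrossedProduct μ R}
    (h : ∀ (X : BanachSp.{w} 𝕜) (ρ : R.mem X) (x : X), orbitMap μ ρ x c = orbitMap μ ρ x d) :
    c = d := by
  suffices h_norm : ‖c - d‖ ≤ 0 from sub_eq_zero.1 (norm_le_zero_iff.1 h_norm)
  refine le_of_forall_pos_le_add fun ε hε => ?_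
  obtain ⟨f, hf⟩ := Metric.denseRange_iff.1 (denseRange_q μ R) (c - d) (ε / 2) (half_pos hε)
  rw [dist_eq_norm] at hf
  have h_q : ‖q μ R f‖ ≤ ε / 2 := by
    rw [norm_q]
    refine sigma_le μ R (half_pos hε).le fun X ρ hρ => ?_
    have h_rep : integratedRep μ ⟨ρ, hρ⟩ (c - d) = 0 := by
      rw [map_sub, sub_eq_zero]
      exact ContinuousLinearMap.ext (h X ⟨ρ, hρ⟩)
    rw [← integratedRep_q μ ⟨ρ, hρ⟩, ← norm_neg, ← zero_sub, ← h_rep, ← map_sub]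
    exact (repContractive_integratedRep μ _ _).trans hf.le
  calc ‖c - d‖ ≤ ‖c - d - q μ R f‖ + ‖q μ R f‖ := norm_le_norm_sub_add _ _
    _ ≤ 0 + ε := by linarith

theorem norm_q_coeffMul_le {a : A} {C : ℝ} (hC : 0 ≤ C)
    (h : ∀ X : BanachSp.{w} 𝕜, ∀ ρ ∈ R.mem X, ‖ρ.π a‖ ≤ C) (f : C_c(G, A)) :
    ‖(q μ R ∘ₗ coeffMul 𝕜 G a) f‖ ≤ C * ‖q μ R f‖ := by
  rw [LinearMap.comp_apply, norm_q, norm_q]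
  refine sigma_le μ R (mul_nonneg hC (sigma_nonneg μ R f)) fun X ρ hρ => ?_
  rw [ρ.integrated_coeffMul μ]
  exact norm_mul_le_of_le (h X ρ hρ) (norm_integrated_le_sigma μ R hρ f)

theorem norm_q_translate_le {r : G} {C : ℝ} (hC : 0 ≤ C)
    (h : ∀ X : BanachSp.{w} 𝕜, ∀ ρ ∈ R.mem X, ‖ρ.U r‖ ≤ C) (f : C_c(G, A)) :
    ‖(q μ R ∘ₗ translate α r) f‖ ≤ C * ‖q μ R f‖ := by
  rw [LinearMap.comp_apply, norm_q, norm_q]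
  refine sigma_le μ R (mul_nonneg hC (sigma_nonneg μ R f)) fun X ρ hρ => ?_
  rw [ρ.integrated_translate μ]
  exact norm_mul_le_of_le (h X ρ hρ) (norm_integrated_le_sigma μ R hρ f)

variable (R) in
/-- The action of `a ∈ A` on the crossed product from the left, `q^R(f) ↦ q^R(a f)`. -/
def algMult (a : A) : CrossedProduct μ R →L[𝕜] CrossedProduct μ R :=
  (q μ R ∘ₗ coeffMul 𝕜 G a).extendOfNorm (q μ R)

variable (R) in
/-- The action of `r ∈ G` on the crossed product from the left, `q^R(f) ↦ q^R(α_r(f(r⁻¹ ·)))`. -/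
def groupMult (r : G) : CrossedProduct μ R →L[𝕜] CrossedProduct μ R :=
  (q μ R ∘ₗ translate α r).extendOfNorm (q μ R)

theorem algMult_q (a : A) (f : C_c(G, A)) :
    algMult μ R a (q μ R f) = q μ R (coeffMul 𝕜 G a f) := by
  obtain ⟨C, ν, -, hR⟩ := R.bdd
  exact LinearMap.extendOfNorm_eq (denseRange_q μ R)
    ⟨_, norm_q_coeffMul_le μ (by positivity) fun X ρ hρ => (hR X ρ hρ).1 a⟩ f

theorem groupMult_q (r : G) (f : C_c(G, A)) :
    groupMult μ R r (q μ R f) = q μ R (translate α r f) := by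
  obtain ⟨C, ν, -, hR⟩ := R.bdd
  exact LinearMap.extendOfNorm_eq (denseRange_q μ R)
    ⟨_, norm_q_translate_le μ (ν r).2 fun X ρ hρ => (hR X ρ hρ).2 r⟩ f

theorem norm_algMult_le {a : A} {C : ℝ} (hC : 0 ≤ C)
    (h : ∀ X : BanachSp.{w} 𝕜, ∀ ρ ∈ R.mem X, ‖ρ.π a‖ ≤ C) : ‖algMult μ R a‖ ≤ C :=
  LinearMap.opNorm_extendOfNorm_le (denseRange_q μ R) hC (norm_q_coeffMul_le μ hC h)

theorem norm_groupMult_le {r : G} {C : ℝ} (hC : 0 ≤ C)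
    (h : ∀ X : BanachSp.{w} 𝕜, ∀ ρ ∈ R.mem X, ‖ρ.U r‖ ≤ C) : ‖groupMult μ R r‖ ≤ C :=
  LinearMap.opNorm_extendOfNorm_le (denseRange_q μ R) hC (norm_q_translate_le μ hC h)

theorem π_comp_orbitMap (ρ : R.mem X) (x : X) (a : A) :
    ρ.1.π a ∘L orbitMap μ ρ x = orbitMap μ ρ x ∘L algMult μ R a := by
  refine clm_ext fun f => ?_
  simp only [ContinuousLinearMap.comp_apply, orbitMap_apply, algMult_q, integratedRep_q,
    ContCovRep.integrated_coeffMul, mul_apply_eq_comp]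

theorem U_comp_orbitMap (ρ : R.mem X) (x : X) (r : G) :
    ρ.1.U r ∘L orbitMap μ ρ x = orbitMap μ ρ x ∘L groupMult μ R r := by
  refine clm_ext fun f => ?_
  simp only [ContinuousLinearMap.comp_apply, orbitMap_apply, groupMult_q, integratedRep_q,
    ContCovRep.integrated_translate, mul_apply_eq_comp]

@[simp] theorem orbitMap_algMult (ρ : R.mem X) (x : X) (a : A) (c : CrossedProduct μ R) :
    orbitMap μ ρ x (algMult μ R a c) = ρ.1.π a (orbitMap μ ρ x c) :=
  (DFunLike.congr_fun (π_comp_orbitMap μ ρ x a) c).symm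

@[simp] theorem orbitMap_groupMult (ρ : R.mem X) (x : X) (r : G) (c : CrossedProduct μ R) :
    orbitMap μ ρ x (groupMult μ R r c) = ρ.1.U r (orbitMap μ ρ x c) :=
  (DFunLike.congr_fun (U_comp_orbitMap μ ρ x r) c).symm

theorem continuous_groupMult_apply (c : CrossedProduct μ R) :
    Continuous fun r => groupMult μ R r c := by
  refine continuous_iff_continuousAt.2 fun r₀ => ?_
  obtain ⟨K, hK, hr₀⟩ := exists_compact_mem_nhds r₀
  obtain ⟨C, ν, hν, hR⟩ := R.bdd
  obtain ⟨M, hM⟩ := hν K hK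
  have h_bound : ∀ᶠ r in 𝓝 r₀, ‖groupMult μ R r‖ ≤ M :=
    mem_of_superset hr₀ fun r hr => norm_groupMult_le μ M.2 fun X ρ hρ =>
      ((hR X ρ hρ).2 r).trans (NNReal.coe_le_coe.2 (hM (mem_image_of_mem ν hr)))
  refine tendsto_of_dense_span h_bound ((denseRange_q μ R).mono Submodule.subset_span) ?_ c
  rintro _ ⟨f, rfl⟩
  simpa only [groupMult_q] using (continuous_q_translate μ R f).tendsto r₀

variable (R) in
/-- The covariant representation of the system on the crossed product, by left multiplications. -/
def leftRep : ContCovRep α (CrossedProduct μ R) where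
  π :=
    { toFun := algMult μ R
      map_smul' := fun k a => ContinuousLinearMap.ext fun c => ext_orbitMap μ fun X ρ x => by simp
      map_zero' := ContinuousLinearMap.ext fun c => ext_orbitMap μ fun X ρ x => by simp
      map_add' := fun a b => ContinuousLinearMap.ext fun c => ext_orbitMap μ fun X ρ x => by simp
      map_mul' := fun a b => ContinuousLinearMap.ext fun c => ext_orbitMap μ fun X ρ x => by simp }
  U :=
    { toFun := groupMult μ R
      map_one' := ContinuousLinearMap.ext fun c => ext_orbitMap μ fun X ρ x => by simp
      map_mul' := fun r s => ContinuousLinearMap.ext fun c => ext_orbitMap μ fun X ρ x => by simp }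
  covariant a s := ContinuousLinearMap.ext fun c => ext_orbitMap μ fun X ρ x => by
    simp [ρ.1.covariant]
  bounded := by
    obtain ⟨C, ν, -, hR⟩ := R.bdd
    exact ⟨C, fun a => norm_algMult_le μ (by positivity) fun X ρ hρ => (hR X ρ hρ).1 a⟩
  strongCont := continuous_groupMult_apply μ

theorem orbitMap_mul (ρ : R.mem X) (x : X) (c d : CrossedProduct μ R) :
    orbitMap μ ρ x (c * d) = orbitMap μ ρ (orbitMap μ ρ x d) c :=
  DFunLike.congr_fun (map_mul (integratedRep μ ρ) c d) x

theorem intertwines_orbitMap (ρ : R.mem X) (x : X) :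
    (leftRep μ R).Intertwines ρ.1 (orbitMap μ ρ x) :=
  ⟨π_comp_orbitMap μ ρ x, U_comp_orbitMap μ ρ x⟩

variable (R) in
theorem leftRep_integrated (f : C_c(G, A)) (c : CrossedProduct μ R) :
    (leftRep μ R).integrated μ f c = q μ R f * c := by
  refine ext_orbitMap μ fun X ρ x => ?_
  rw [orbitMap_mul, orbitMap_apply μ ρ _ (q μ R f), integratedRep_q]
  exact (DFunLike.congr_fun ((intertwines_orbitMap μ ρ x).integrated f) c).symm

variable (R) in
theorem isLeftCentralizer_algMult (a : A) : IsLeftCentralizer (algMult μ R a) := fun c d =>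
  ext_orbitMap μ fun X ρ x => by simp only [orbitMap_mul, orbitMap_algMult]

variable (R) in
theorem isLeftCentralizer_groupMult (r : G) : IsLeftCentralizer (groupMult μ R r) := fun c d =>
  ext_orbitMap μ fun X ρ x => by simp only [orbitMap_mul, orbitMap_groupMult]

variable (R) in
theorem repNonDegenerate_leftRep {M : ℝ} (hA : HasBddLeftApproxId A M) :
    RepNonDegenerate (leftRep μ R).π := by
  obtain ⟨l, _, hM, hl⟩ := hA
  refine .of_subset_closure ((denseRange_q μ R).mono Submodule.subset_span) ?_
  rintro _ ⟨f, rfl⟩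
  exact mem_closure_of_tendsto (tendsto_q_coeffMul μ R hM hl f)
    (.of_forall fun u => ⟨u, q μ R f, (algMult_q μ u f).symm⟩)

theorem repNonDegenerate_integratedRep {ρ : R.mem X} (hρ : RepNonDegenerate ρ.1.π) :
    RepNonDegenerate (integratedRep μ ρ) := by
  refine .of_subset_closure hρ ?_
  rintro _ ⟨a, x, rfl⟩
  have h := ρ.1.tendsto_integrated_translate_tens μ 1 a x
  rw [map_one, one_apply_eq_self] at h
  exact mem_closure_of_tendsto h
    (.of_forall fun φ => ⟨q μ R (translate α 1 (tens 𝕜 φ a)), x, by rw [integratedRep_q]⟩)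

variable {ν : G → ℝ≥0}

theorem eventually_norm_q_tens_le (hR : ∀ X : BanachSp.{w} 𝕜, R.mem X ⊆ boundedReps α ν X)
    {M : ℝ} (hν : ∀ᶠ r in 𝓝 (1 : G), (ν r : ℝ) ≤ M) :
    ∀ᶠ φ in bumps μ, ∀ a : A, ‖q μ R (tens 𝕜 φ a)‖ ≤ M * ‖a‖ := by
  obtain ⟨W, hW, hW_closed, hWM⟩ := exists_mem_nhds_isClosed_subset hν
  have hM : 0 ≤ M := (ν 1).2.trans hν.self_of_nhds
  filter_upwards [eventually_bumps μ hW] with φ ⟨h0, h1, hφW⟩ a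
  have h_supp : tsupport (tens 𝕜 φ a) ⊆ W := closure_minimal
    (fun s hs => not_imp_comm.1 (hφW s) fun h => hs (by simp [h])) hW_closed
  have h_int : ∫ s, ‖tens 𝕜 φ a s‖ ∂μ = ‖a‖ := by
    simp only [tens_apply, norm_smul, RCLike.norm_ofReal, abs_of_nonneg (h0 _),
      integral_mul_const, h1, one_mul]
  refine (norm_q_le_mul_integral_norm μ R zero_le_one hM fun X ρ hρ =>
    ⟨fun b => (one_mul ‖b‖).symm ▸ (hR X hρ).2.1 b,
      fun s hs => ((hR X hρ).2.2 s).trans (hWM (h_supp hs))⟩).trans_eq ?_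
  rw [h_int, one_mul]

theorem hasBddLeftApproxId_crossedProduct
    (hA : ∀ ε : ℝ, 0 < ε → HasBddLeftApproxId A (1 + ε))
    (hν : ∀ ε : ℝ, 0 < ε → ∀ᶠ r in 𝓝 (1 : G), (ν r : ℝ) ≤ 1 + ε)
    (hR : ∀ X : BanachSp.{w} 𝕜, R.mem X ⊆ boundedReps α ν X) {ε : ℝ} (hε : 0 < ε) :
    HasBddLeftApproxId (CrossedProduct μ R) (1 + ε) := by
  obtain ⟨η, hη, hηε⟩ : ∃ η : ℝ, 0 < η ∧ (1 + η) * (1 + η) ≤ 1 + ε :=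
    ⟨√(1 + ε) - 1, sub_pos.2 (Real.lt_sqrt_of_sq_lt (by linarith)),
      by rw [add_sub_cancel, Real.mul_self_sqrt (by linarith)]⟩
  have h_nondeg := repNonDegenerate_leftRep μ R (hA η hη)
  obtain ⟨l, _, hM, hl⟩ := hA η hη
  refine ⟨map (fun p => q μ R (tens 𝕜 p.1 p.2)) (bumps μ ×ˢ l), inferInstance, ?_, fun c => ?_⟩
  · rw [eventually_map]
    filter_upwards [(eventually_norm_q_tens_le μ hR (hν η hη)).prod_mk hM] with p ⟨hq, hp⟩
    exact (hq p.2).trans ((mul_le_mul_of_nonneg_left hp (by positivity)).trans hηε)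
  · refine tendsto_map'_iff.2
      (((leftRep μ R).tendsto_integrated_tens_approxId μ h_nondeg hM hl c).congr fun p => ?_)
    rw [leftRep_integrated, Function.comp_apply]

end LeftRegular

section Disintegration

variable {𝕜 G A B X : Type*} [RCLike 𝕜] [Group G] [TopologicalSpace G]
  [NonUnitalNormedRing A] [NormedSpace 𝕜 A] {α : DynSys 𝕜 G A}
  [NonUnitalNormedRing B] [NormedSpace 𝕜 B] [CompleteSpace B]
  [NormedAddCommGroup X] [NormedSpace 𝕜 X] [CompleteSpace X] {τ : ContCovRep α B}
  {T : B →ₙₐ[𝕜] (X →L[𝕜] X)}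

namespace ContCovRep

variable [WeaklyLocallyCompactSpace G] (hπ : ∀ a, IsLeftCentralizer (τ.π a))
  (hU : ∀ r, IsLeftCentralizer (τ.U r)) (hT : RepNonDegenerate T) (hc : RepContractive T)
  (hB : ∀ ε : ℝ, 0 < ε → HasBddLeftApproxId B (1 + ε))

/-- The covariant representation on `X` obtained by transporting, along a non-degenerate
contractive representation `T` of `B` on `X`, a covariant representation `τ` on `B` by left
centralizers. It is determined by `π(a) T(b) x = T(τ.π(a) b) x` and `U_r T(b) x = T(τ.U_r b) x`. -/
def disintegrate : ContCovRep α X where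
  π :=
    { toFun := fun a => leftExtend T hc.bounded (τ.π a)
      map_smul' := fun k a => leftExtend_eq hT hc hB (hπ _) fun b x => by
        simp [leftExtend_apply hT hc hB, hπ]
      map_zero' := leftExtend_eq hT hc hB (hπ _) fun b x => by simp
      map_add' := fun a a' => leftExtend_eq hT hc hB (hπ _) fun b x => by
        simp [leftExtend_apply hT hc hB, hπ]
      map_mul' := fun a a' => leftExtend_eq hT hc hB (hπ _) fun b x => by
        simp [leftExtend_apply hT hc hB, hπ] }
  U :=
    { toFun := fun r => leftExtend T hc.bounded (τ.U r)
      map_one' := leftExtend_eq hT hc hB (hU _) fun b x => by simp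
      map_mul' := fun r s => leftExtend_eq hT hc hB (hU _) fun b x => by
        simp [leftExtend_apply hT hc hB, hU] }
  covariant a s := leftExtend_eq hT hc hB (hπ _) fun b x => by
    simp [leftExtend_apply hT hc hB, hU, hπ, τ.covariant]
  bounded := τ.bounded.imp fun C hC a => (norm_leftExtend_le hT hc hB (hπ a)).trans (hC a)
  strongCont x := continuous_iff_continuousAt.2 fun r => by
    obtain ⟨K, hK, hr⟩ := exists_compact_mem_nhds r
    obtain ⟨C, hC⟩ := bdd_on_compact τ.strongCont hK
    have h_bound : ∀ᶠ s in 𝓝 r, ‖leftExtend T hc.bounded (τ.U s)‖ ≤ C :=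
      mem_of_superset hr fun s hs => (norm_leftExtend_le hT hc hB (hU s)).trans (hC s hs)
    refine tendsto_of_dense_span h_bound hT ?_ x
    rintro _ ⟨b, y, rfl⟩
    simp only [MonoidHom.coe_mk, OneHom.coe_mk, leftExtend_apply hT hc hB (hU _)]
    exact (((repCLM T hc.bounded).flip y).continuous.comp (τ.strongCont b)).tendsto r

theorem norm_disintegrate_π_le (a : A) : ‖(disintegrate hπ hU hT hc hB).π a‖ ≤ ‖τ.π a‖ :=
  norm_leftExtend_le hT hc hB (hπ a)

theorem norm_disintegrate_U_le (r : G) : ‖(disintegrate hπ hU hT hc hB).U r‖ ≤ ‖τ.U r‖ :=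
  norm_leftExtend_le hT hc hB (hU r)

theorem intertwines_disintegrate (x : X) :
    τ.Intertwines (disintegrate hπ hU hT hc hB) ((repCLM T hc.bounded).flip x) :=
  ⟨fun a => ContinuousLinearMap.ext fun b => leftExtend_apply hT hc hB (hπ a) b x,
    fun r => ContinuousLinearMap.ext fun b => leftExtend_apply hT hc hB (hU r) b x⟩

theorem disintegrate_integrated_apply [MeasurableSpace G] [BorelSpace G] (μ : Measure G)
    [IsFiniteMeasureOnCompacts μ] (f : C_c(G, A)) (b : B) (x : X) :
    (disintegrate hπ hU hT hc hB).integrated μ f (T b x) = T (τ.integrated μ f b) x :=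
  DFunLike.congr_fun ((intertwines_disintegrate hπ hU hT hc hB x).integrated f) b

theorem repNonDegenerate_disintegrate (hτ : RepNonDegenerate τ.π) {M : ℝ}
    (hA : HasBddLeftApproxId A M) : RepNonDegenerate (disintegrate hπ hU hT hc hB).π := by
  obtain ⟨l, _, hM, hl⟩ := hA
  refine .of_subset_closure hT ?_
  rintro _ ⟨b, x, rfl⟩
  have h_lim : Tendsto (fun u => T (τ.π u b) x) l (𝓝 (T b x)) :=
    (((repCLM T hc.bounded).flip x).continuous.tendsto b).comp
      (hτ.tendsto_approxId τ.bounded hM hl b)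
  exact mem_closure_of_tendsto h_lim
    (.of_forall fun u => ⟨u, T b x, (leftExtend_apply hT hc hB (hπ u) b x).symm⟩)

end ContCovRep

end Disintegration

section CrossedProductRepresentations

variable {𝕜 G A : Type*} [RCLike 𝕜] [Group G] [TopologicalSpace G] [IsTopologicalGroup G]
  [T2Space G] [LocallyCompactSpace G] [MeasurableSpace G] [BorelSpace G]
  [NonUnitalNormedRing A] [NormedSpace 𝕜 A] [CompleteSpace A]
  [IsScalarTower 𝕜 A A] [SMulCommClass 𝕜 A A]
  (μ : Measure G) [μ.IsHaarMeasure] {α : DynSys 𝕜 G A} {R : UnifBddClass.{w} α}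
  {X Y : BanachSp.{w} 𝕜}

open CrossedProduct

theorem repInvariant_integratedRep_iff {ρ : R.mem X} {Z : Submodule 𝕜 X}
    (hZ : IsClosed (Z : Set X)) :
    RepInvariant (integratedRep μ ρ) Z ↔
      ∀ f : C_c(G, A), ∀ x ∈ Z, ρ.1.integrated μ f x ∈ Z := by
  refine ⟨fun h f x hx => integratedRep_q μ ρ f ▸ h (q μ R f) x hx, fun h c x hx => ?_⟩
  induction c using CrossedProduct.induction with
  | hc => exact hZ.preimage (orbitMap μ ρ x).continuous
  | h f => exact (integratedRep_q μ ρ f).symm ▸ h f x hx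

theorem repIntertwines_integratedRep_iff {ρ : R.mem X} {τ : R.mem Y} {Φ : X →L[𝕜] Y} :
    RepIntertwines (integratedRep μ ρ) (integratedRep μ τ) Φ ↔
      ∀ f : C_c(G, A), τ.1.integrated μ f ∘L Φ = Φ ∘L ρ.1.integrated μ f := by
  refine ⟨fun h f => ?_, fun h c => ContinuousLinearMap.ext fun x => ?_⟩
  · simpa only [integratedRep_q] using h (q μ R f)
  · have h_orbit : orbitMap μ τ (Φ x) = Φ ∘L orbitMap μ ρ x := clm_ext fun f => by
      simpa only [ContinuousLinearMap.comp_apply, orbitMap_apply, integratedRep_q]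
        using DFunLike.congr_fun (h f) x
    exact DFunLike.congr_fun h_orbit c

theorem CrossedProduct.invol_q_of_sigma_invol_le [StarRing A] [StarModule 𝕜 A]
    [ContinuousStar A] (h : ∃ C : ℝ, ∀ f : C_c(G, A), sigma μ R (BanachCP.invol α f) ≤
      C * sigma μ R f) (f : C_c(G, A)) :
    CrossedProduct.invol μ R (q μ R f) = q μ R (BanachCP.invol α f) :=
  LinearMap.extendOfNorm_eq (f := involLin μ R) (denseRange_q μ R)
    (h.imp fun C hC g => (norm_q μ R _).trans_le ((hC g).trans_eq (by rw [norm_q]))) f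

theorem repInvolutive_integratedRep_iff [StarRing A] [StarModule 𝕜 A] [ContinuousStar A]
    (h : ∃ C : ℝ, ∀ f : C_c(G, A), sigma μ R (BanachCP.invol α f) ≤ C * sigma μ R f)
    {ρ : R.mem X} :
    RepInvolutive (CrossedProduct.invol μ R) (integratedRep μ ρ) ↔
      ∃ H : InnerProductSpace 𝕜 X, H.toNormedSpace = X.space ∧
        ∀ (f : C_c(G, A)) (x y : X), H.inner (ρ.1.integrated μ f x) y =
          H.inner x (ρ.1.integrated μ (BanachCP.invol α f) y) := by
  refine exists_congr fun H => and_congr_right fun _ =>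
    ⟨fun h_adj f x y => ?_, fun h_adj c x y => ?_⟩
  · rw [← integratedRep_q μ ρ, ← integratedRep_q μ ρ, ← invol_q_of_sigma_invol_le μ h]
    exact h_adj _ x y
  · have h_inner : Continuous fun p : X × X => H.inner p.1 p.2 := continuous_inner
    have h_invol : Continuous (CrossedProduct.invol μ R) :=
      ((involLin μ R).extendOfNorm (q μ R)).continuous
    induction c using CrossedProduct.induction with
    | hc =>
      exact isClosed_eq
        (h_inner.comp ((orbitMap μ ρ x).continuous.prodMk continuous_const))
        (h_inner.comp (continuous_const.prodMk ((orbitMap μ ρ y).continuous.comp h_invol)))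
    | h f =>
      rw [invol_q_of_sigma_invol_le μ h, integratedRep_q, integratedRep_q]
      exact h_adj f x y

end CrossedProductRepresentations

section BoundedReps

variable {𝕜 G A : Type*} [RCLike 𝕜] [Group G] [TopologicalSpace G] [IsTopologicalGroup G]
  [T2Space G] [LocallyCompactSpace G] [MeasurableSpace G] [BorelSpace G]
  [NonUnitalNormedRing A] [NormedSpace 𝕜 A] [CompleteSpace A]
  [IsScalarTower 𝕜 A A] [SMulCommClass 𝕜 A A]
  (μ : Measure G) [μ.IsHaarMeasure] {α : DynSys 𝕜 G A} {R : UnifBddClass.{w} α}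
  {X : BanachSp.{w} 𝕜} {ν : G → ℝ≥0}

open CrossedProduct

theorem exists_integrated_eq_of_repContractive
    (hR : ∀ X : BanachSp.{w} 𝕜, R.mem X ⊆ boundedReps α ν X) {M : ℝ} (hA : HasBddLeftApproxId A M)
    (hB : ∀ ε : ℝ, 0 < ε → HasBddLeftApproxId (CrossedProduct μ R) (1 + ε))
    {T : CrossedProduct μ R →ₙₐ[𝕜] (X →L[𝕜] X)} (hT : RepNonDegenerate T)
    (hc : RepContractive T) :
    ∃ ρ ∈ boundedReps α ν X, ∀ f, ρ.integrated μ f = T (q μ R f) := by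
  have h_alg : ∀ a, IsLeftCentralizer ((leftRep μ R).π a) := isLeftCentralizer_algMult μ R
  have h_grp : ∀ r, IsLeftCentralizer ((leftRep μ R).U r) := isLeftCentralizer_groupMult μ R
  refine ⟨.disintegrate h_alg h_grp hT hc hB, ⟨?_, fun a => ?_, fun r => ?_⟩,
    fun f => hT.clm_ext fun c x => ?_⟩
  · exact ContCovRep.repNonDegenerate_disintegrate _ _ hT hc hB (repNonDegenerate_leftRep μ R hA) hA
  · exact (ContCovRep.norm_disintegrate_π_le _ _ hT hc hB a).trans
      (norm_algMult_le μ (norm_nonneg a) fun X ρ hρ => (hR X hρ).2.1 a)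
  · exact (ContCovRep.norm_disintegrate_U_le _ _ hT hc hB r).trans
      (norm_groupMult_le μ (ν r).2 fun X ρ hρ => (hR X hρ).2.2 r)
  · rw [ContCovRep.disintegrate_integrated_apply, leftRep_integrated, map_mul, mul_apply_eq_comp]

theorem integratedRep_eq_iff {ρ : R.mem X} {T : CrossedProduct μ R →ₙₐ[𝕜] (X →L[𝕜] X)}
    (hc : RepContractive T) :
    integratedRep μ ρ = T ↔ ∀ f, ρ.1.integrated μ f = T (q μ R f) := by
  refine ⟨fun h f => by rw [← h, integratedRep_q], fun h => ?_⟩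
  have h_clm : repCLM (integratedRep μ ρ) (repContractive_integratedRep μ ρ).bounded =
      repCLM T hc.bounded := clm_ext fun f => by rw [repCLM_apply, repCLM_apply, integratedRep_q, h]
  ext c : 1
  exact DFunLike.congr_fun h_clm c

theorem bijOn_integratedRep (hR : ∀ X : BanachSp.{w} 𝕜, R.mem X ⊆ boundedReps α ν X) {M : ℝ}
    (hA : HasBddLeftApproxId A M)
    (hB : ∀ ε : ℝ, 0 < ε → HasBddLeftApproxId (CrossedProduct μ R) (1 + ε))
    (hX : boundedReps α ν X ⊆ R.mem X) :
    BijOn (fun ρ : R.mem X => integratedRep μ ρ) {ρ : R.mem X | ρ.1 ∈ boundedReps α ν X}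
      {T : CrossedProduct μ R →ₙₐ[𝕜] (X →L[𝕜] X) | RepNonDegenerate T ∧ RepContractive T} := by
  refine ⟨fun ρ hρ => ⟨repNonDegenerate_integratedRep μ hρ.1, repContractive_integratedRep μ ρ⟩,
    fun ρ hρ τ _ h => ?_, fun T ⟨hT, hc⟩ => ?_⟩
  · have h_eq : ∀ f, ρ.1.integrated μ f = τ.1.integrated μ f := fun f => by
      rw [← integratedRep_q, ← integratedRep_q]
      exact DFunLike.congr_fun h (q μ R f)
    exact Subtype.ext (ContCovRep.eq_of_intertwines_id
      ((ContCovRep.intertwines_iff_integrated μ hρ.1).2 fun f => by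
        rw [ContinuousLinearMap.comp_id, ContinuousLinearMap.id_comp, h_eq]))
  · obtain ⟨ρ, hρ, h⟩ := exists_integrated_eq_of_repContractive μ hR hA hB hT hc
    exact ⟨⟨ρ, hX hρ⟩, hρ, (integratedRep_eq_iff μ hc).2 h⟩

theorem sigma_invol_le [StarRing A] [StarModule 𝕜 A] [ContinuousStar A]
    (hR : ∀ X : BanachSp.{w} 𝕜, ∀ ρ ∈ R.mem X, ρ.Involutive) (f : C_c(G, A)) :
    sigma μ R (BanachCP.invol α f) ≤ sigma μ R f :=
  sigma_le μ R (sigma_nonneg μ R f) fun X ρ hρ =>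
    (norm_integrated_invol_le μ ρ (hR X ρ hρ) f).trans (norm_integrated_le_sigma μ R hρ f)

end BoundedReps

theorem eventually_le_of_iInf_iSup_eq_one {G : Type*} [One G] [TopologicalSpace G]
    {𝒵 : Set (Set G)} (h𝒵 : (𝓝 (1 : G)).HasBasis (fun V => V ∈ 𝒵) id) {K : Set G}
    (h𝒵K : ∀ V ∈ 𝒵, V ⊆ K) {ν : G → ℝ≥0} (hν : BddAbove (ν '' K))
    (hν1 : (⨅ V : 𝒵, ⨆ r : (V : Set G), ν r) = (1 : ℝ≥0)) {ε : ℝ} (hε : 0 < ε) :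
    ∀ᶠ r in 𝓝 (1 : G), (ν r : ℝ) ≤ 1 + ε := by
  lift ε to ℝ≥0 using hε.le
  have : Nonempty 𝒵 := nonempty_subtype.2 h𝒵.ex_mem
  obtain ⟨⟨V, hV⟩, hVε⟩ : ∃ V : 𝒵, ⨆ r : (V : Set G), ν r < 1 + ε :=
    exists_lt_of_ciInf_lt (hν1.trans_lt (lt_add_of_pos_right _ (NNReal.coe_pos.1 hε)))
  filter_upwards [h𝒵.mem_of_mem hV] with r hr
  have h_bdd : BddAbove (range fun s : V => ν s) :=
    hν.mono (range_subset_iff.2 fun s => mem_image_of_mem ν (h𝒵K V hV s.2))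
  exact_mod_cast (le_ciSup h_bdd ⟨r, hr⟩).trans hVε.le

end

end BanachCP

theorem theoremt_general {𝕜 G A : Type*} [RCLike 𝕜]
    [Group G] [TopologicalSpace G] [IsTopologicalGroup G] [LocallyCompactSpace G] [T2Space G]
    [MeasurableSpace G] [BorelSpace G] (μ : Measure G) [μ.IsHaarMeasure]
    [NonUnitalNormedRing A] [NormedSpace 𝕜 A] [IsScalarTower 𝕜 A A] [SMulCommClass 𝕜 A A]
    [CompleteSpace A]
    {α : DynSys 𝕜 G A} (hA : ∀ ε : ℝ, 0 < ε → HasBddLeftApproxId A (1 + ε))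
    {ν : G → ℝ≥0} (hν : ∀ ε : ℝ, 0 < ε → ∀ᶠ r in 𝓝 (1 : G), (ν r : ℝ) ≤ 1 + ε)
    {R : UnifBddClass.{w} α} (hR : ∀ X : BanachSp.{w} 𝕜, R.mem X ⊆ boundedReps α ν X) :
    (∀ X : BanachSp.{w} 𝕜, boundedReps α ν X ⊆ R.mem X →
      BijOn (fun ρ : R.mem X => integratedRep μ ρ) {ρ : R.mem X | ρ.1 ∈ boundedReps α ν X}
        {T : CrossedProduct μ R →ₙₐ[𝕜] (X →L[𝕜] X) | RepNonDegenerate T ∧ RepContractive T}) ∧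
    (∀ (X : BanachSp.{w} 𝕜) (ρ : R.mem X) (Z : Submodule 𝕜 X), IsClosed (Z : Set X) →
      (ρ.1.Invariant Z ↔ RepInvariant (integratedRep μ ρ) Z)) ∧
    (∀ (X Y : BanachSp.{w} 𝕜) (ρ : R.mem X) (τ : R.mem Y) (Φ : X →L[𝕜] Y),
      ρ.1.Intertwines τ.1 Φ ↔ RepIntertwines (integratedRep μ ρ) (integratedRep μ τ) Φ) ∧
    (∀ [StarRing A] [StarModule 𝕜 A] [ContinuousStar A],
      (∃ C : ℝ, ∀ f, sigma μ R (invol α f) ≤ C * sigma μ R f) →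
      ∀ (X : BanachSp.{w} 𝕜) (ρ : R.mem X),
        ρ.1.Involutive ↔ RepInvolutive (CrossedProduct.invol μ R) (integratedRep μ ρ)) := by
  refine ⟨fun X hX => ?_, fun X ρ Z hZ => ?_, fun X Y ρ τ Φ => ?_, fun h X ρ => ?_⟩
  · exact bijOn_integratedRep μ hR (hA 1 one_pos)
      (fun ε hε => hasBddLeftApproxId_crossedProduct μ hA hν hR hε) hX
  · exact (ContCovRep.invariant_iff_integrated μ (hR X ρ.2).1 (hA 1 one_pos) hZ).trans
      (repInvariant_integratedRep_iff μ hZ).symm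
  · exact (ContCovRep.intertwines_iff_integrated μ (hR X ρ.2).1).trans
      (repIntertwines_integratedRep_iff μ).symm
  · exact (ContCovRep.involutive_iff_integrated μ (hR X ρ.2).1).trans
      (repInvolutive_integratedRep_iff μ h).symm

theorem theoremt {𝕜 G A : Type*} [RCLike 𝕜]
    [Group G] [TopologicalSpace G] [IsTopologicalGroup G] [LocallyCompactSpace G] [T2Space G]
    [MeasurableSpace G] [BorelSpace G] (μ : Measure G) [μ.IsHaarMeasure]
    [NonUnitalNormedRing A] [NormedSpace 𝕜 A] [IsScalarTower 𝕜 A A] [SMulCommClass 𝕜 A A]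
    [CompleteSpace A]
    (α : DynSys 𝕜 G A)
    (hA : ∀ ε : ℝ, 0 < ε → HasBddLeftApproxId A (1 + ε))
    (𝒵 : Set (Set G)) (h𝒵 : (𝓝 (1 : G)).HasBasis (fun V => V ∈ 𝒵) id)
    (h𝒵K : ∃ K : Set G, IsCompact K ∧ ∀ V ∈ 𝒵, V ⊆ K)
    (ν : G → ℝ≥0) (hν : ∀ K : Set G, IsCompact K → BddAbove (ν '' K))
    (hν1 : (⨅ V : 𝒵, ⨆ r : (V : Set G), ν r) = (1 : ℝ≥0))
    (R : UnifBddClass.{w} α)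
    (hR : ∀ X : BanachSp.{w} 𝕜, ∀ ρ ∈ R.mem X,
      RepNonDegenerate ρ.π ∧ RepContractive ρ.π ∧ ∀ r : G, ‖ρ.U r‖ ≤ ν r)
    (𝓧 : Set (BanachSp.{w} 𝕜))
    (hR' : ∀ X ∈ 𝓧, boundedReps α ν X ⊆ R.mem X)
    (hne : ∃ X ∈ 𝓧, (boundedReps α ν X).Nonempty) :
    -- integration is a bijection onto the non-degenerate contractive representations
    (∀ X ∈ 𝓧, BijOn (fun ρ : R.mem X => integratedRep μ ρ)
      {ρ : R.mem X | ρ.1 ∈ boundedReps α ν X}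
      {T : CrossedProduct μ R →ₙₐ[𝕜] (X →L[𝕜] X) | RepNonDegenerate T ∧ RepContractive T}) ∧
    -- it preserves the closed invariant subspaces
    (∀ X ∈ 𝓧, ∀ ρ : R.mem X, ρ.1 ∈ boundedReps α ν X →
      ∀ Z : Submodule 𝕜 X, IsClosed (Z : Set X) →
        (ρ.1.Invariant Z ↔ RepInvariant (integratedRep μ ρ) Z)) ∧
    -- it preserves the bounded intertwining operators
    (∀ X ∈ 𝓧, ∀ Y ∈ 𝓧, ∀ (ρ : R.mem X) (τ : R.mem Y),
      ρ.1 ∈ boundedReps α ν X → τ.1 ∈ boundedReps α ν Y → ∀ Φ : X →L[𝕜] Y,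
        (ρ.1.Intertwines τ.1 Φ ↔ RepIntertwines (integratedRep μ ρ) (integratedRep μ τ) Φ)) ∧
    -- if the system and `R` are involutive, it preserves the property of being involutive
    (∀ [StarRing A] [StarModule 𝕜 A] [ContinuousStar A], α.Involutive →
      (∀ X : BanachSp.{w} 𝕜, ∀ ρ ∈ R.mem X, ρ.Involutive) →
      ∀ X ∈ 𝓧, ∀ ρ : R.mem X, ρ.1 ∈ boundedReps α ν X →
        (ρ.1.Involutive ↔
          RepInvolutive (CrossedProduct.invol μ R) (integratedRep μ ρ))) := by
  obtain ⟨K, hK, h𝒵K⟩ := h𝒵K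
  obtain ⟨h_bij, h_inv, h_int, h_star⟩ := theoremt_general μ hA
    (fun ε hε => eventually_le_of_iInf_iSup_eq_one h𝒵 h𝒵K (hν K hK) hν1 hε) hR
  exact ⟨fun X hX => h_bij X (hR' X hX), fun X _ ρ _ Z hZ => h_inv X ρ Z hZ,
    fun X _ Y _ ρ τ _ _ Φ => h_int X Y ρ τ Φ,
    fun _ hR_star X _ ρ _ => h_star ⟨1, fun f => by simpa using sigma_invol_le μ hR_star f⟩ X ρ⟩
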